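/- **Setting.** Let $m,n\ge 2$, let $C\in\mathbb R_+^{n\times\cdots\times n}$ be a tensor of order $m$, $\|C\|_\infty=\max_i|C_i|$, let $p_1,\dots,p_m\in\Delta^n$ be probability vectors, and let $0<\varepsilon\le 32m\|C\|_\infty$ (so $C\neq0$). For a tensor $X$ let $p_k(X)\in\mathbb R^n$ be its $k$-th marginal. An $\varepsilon$-approximate solution of the (non-regularized) multimarginal optimal transport problem is a tensor $\widehat X\ge 0$ with $p_k(\widehat X)=p_k$ for all $k$ and $\langle C,\widehat X\rangle\le\min\{\langle C,X\rangle: X\ge0,\ p_k(X)=p_k\ \forall k\}+\varepsilon$. **Algorithm.** Put $\gamma=\frac{\varepsilon}{2m\ln n}$, $\varepsilon'=\frac{\varepsilon}{8\|C\|_\infty}$, $\tilde p_k=(1-\frac{\varepsilon'}{4m})p_k+\frac{\varepsilon'}{4mn}\mathbf 1$. For $U=(u_1,\dots,u_m)\in\mathbb R^{mn}$ let $B(U)_{i_1\dots i_m}=\exp\big(\sum_k[u_k]_{i_k}-C_{i_1\dots i_m}/\gamma\big)$, let $\Sigma(U)$ be the sum of its entries, $X(U)=B(U)/\Sigma(U)$,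 $\phi(U)=\gamma\big(\ln\Sigma(U)-\sum_k u_k^\top\tilde p_k\big)$, with gradient blocks $\nabla_k\phi(U)=\gamma\,(p_k(X(U))-\tilde p_k)$, and $F(X)=\langle C,X\rangle+\gamma\langle X,\ln X\rangle$. Start with $\eta^0=\zeta^0=0$, $A_0=0$. For $t=0,1,\dots$: choose $\beta_t\in\arg\min_{\beta\in[0,1]}\phi(\eta^t+\beta(\zeta^t-\eta^t))$ and set $\theta^t=\eta^t+\beta_t(\zeta^t-\eta^t)$; choose a block $I\in\arg\max_k\|\nabla_k\phi(\theta^t)\|_2$; let $\eta^{t+1}$ be $\theta^t$ with block $I$ replaced by $\theta^t_I+\ln\tilde p_I-\ln p_I(B(\theta^t))$; let $a_{t+1}$ be the largest solution of $\phi(\theta^t)-\frac{a^2}{2(A_t+a)}\|\nabla\phi(\theta^t)\|_2^2=\phi(\eta^{t+1})$; set $A_{t+1}=A_t+a_{t+1}$, $\zeta^{t+1}=\zeta^t-a_{t+1}\nabla\phi(\theta^t)$ and $\widehat X^{t+1}=\frac{a_{t+1}X(\theta^t)+A_t\widehat X^t}{A_{t+1}}$. (If $\nabla\phi(\theta^t)=0$,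 set $\widehat X^{t+1}=X(\theta^t)$, $A_{t+1}=A_t$, $\zeta^{t+1}=\zeta^t$.) Stop at the first $T\ge1$ with $$2\|C\|_\infty\sum_{k=1}^m\|p_k(\widehat X^T)-\tilde p_k\|_1+F(\widehat X^T)+\phi(\eta^T)\le \tfrac{3}{8}\varepsilon .$$ Rounding: put $V_1=\widehat X^T$; for $r=1,\dots,m$ obtain $V_{r+1}$ from $V_r$ by multiplying, for each $j$, all entries with $i_r=j$ by $\min\{[p_r]_j/[p_r(V_r)]_j,1\}$; put $\mathrm{err}_r=p_r-p_r(V_{m+1})$ and output $\widehat X=V_{m+1}+\bigotimes_{r=1}^m\mathrm{err}_r/\|\mathrm{err}_m\|_1^{m-1}$ (with $0/0=0$). **Theorem.** There are absolute constants $K,d$ such that for all $m,n,C,p,\varepsilon$ as above, with $\ell=\ln(2+mn\|C\|_\infty/\varepsilon)$: 1. Whatever choices are made of the minimizers $\beta_t$ and the blocks $I$, the algorithm stops after $T\le K\,\frac{m^2n^{1/2}\|C\|_\infty}{\varepsilon}\,\ell^{\,d}$ iterations, that is $\widetilde O\big(m^2n^{1/2}\|C\|_\infty/\varepsilon\big)$,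 and its output $\widehat X$ is an $\varepsilon$-approximate solution. 2. The algorithm is carried out by an explicit program (the evident loops) for exact real arithmetic, in which each of $+,-,\times,/,\max,\min,|\cdot|,\exp,\ln,\sqrt{\cdot}$, each comparison and each constant costs one operation, and the exact one-dimensional line search ($\min_{\beta\in[0,1]}\ln\sum_i e^{a_i+\beta b_i}-\beta c$, given $a,b\in\mathbb R^{n^m}$ and $c\in\mathbb R$) is a primitive charged $2n^m+1$ operations. Each iteration costs at most $K\,m\,n^m$ operations, and the total cost, including preparation and rounding, is at most $K\,\frac{m^3n^{m+1/2}\|C\|_\infty}{\varepsilon}\,\ell^{\,d}$, that is $\widetilde O\big(m^3n^{m+1/2}\|C\|_\infty/\varepsilon\big)$. -/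

import Mathlib

open Finset

noncomputable section

namespace MOT

/-! ### The multimarginal transport problem -/

/-- Tensors of order `m` and size `n × ⋯ × n`. For real entries, `‖C‖` is the largest absolute value
of an entry, since Mathlib's norm on a finite product is the sup norm. -/
abbrev Tensor (m n : ℕ) (R : Type) : Type := (Fin m → Fin n) → R

/-- Families of `m` vectors of length `n` (marginals, dual variables). -/
abbrev Vecs (m n : ℕ) (R : Type) : Type := Fin m → Fin n → R

variable {m n : ℕ}

/-- The `k`-th marginal of a tensor. -/
def marginal (X : Tensor m n ℝ) (k : Fin m) (j : Fin n) : ℝ :=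
  ∑ i ∈ univ.filter (fun i : Fin m → Fin n => i k = j), X i

/-- The transport cost `⟨C, X⟩`. -/
def cost (C X : Tensor m n ℝ) : ℝ := ∑ i, C i * X i

/-- The feasible set: nonnegative tensors with marginals `p`. -/
def Feasible (p : Vecs m n ℝ) (X : Tensor m n ℝ) : Prop :=
  (∀ i, 0 ≤ X i) ∧ ∀ k j, marginal X k j = p k j

/-- `X` is feasible and its cost is within `ε` of the minimum over the feasible set. -/
def IsApproxSolution (C : Tensor m n ℝ) (p : Vecs m n ℝ) (ε : ℝ) (X : Tensor m n ℝ) : Prop :=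
  Feasible p X ∧ ∀ Y, Feasible p Y → cost C X ≤ cost C Y + ε

/-! ### The entropy-regularized problem and its dual -/

/-- The regularized primal objective `⟨C, X⟩ - γ H(X)` (with `0 log 0 = 0`). -/
def primalObj (C : Tensor m n ℝ) (γ : ℝ) (X : Tensor m n ℝ) : ℝ :=
  cost C X + γ * ∑ i, X i * Real.log (X i)

/-- The tensor `B(U)`. -/
def kernelTensor (C : Tensor m n ℝ) (γ : ℝ) (U : Vecs m n ℝ) : Tensor m n ℝ :=
  fun i => Real.exp (∑ k, U k (i k) - C i / γ)

/-- The sum `Σ(U)` of the entries of `B(U)`. -/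
def kernelSum (C : Tensor m n ℝ) (γ : ℝ) (U : Vecs m n ℝ) : ℝ := ∑ i, kernelTensor C γ U i

/-- The dual objective (to be minimized). -/
def dualObj (C : Tensor m n ℝ) (γ : ℝ) (q U : Vecs m n ℝ) : ℝ :=
  γ * (Real.log (kernelSum C γ U) - ∑ k, ∑ j, U k j * q k j)

/-- The gradient of the dual objective. -/
def dualGrad (C : Tensor m n ℝ) (γ : ℝ) (q U : Vecs m n ℝ) : Vecs m n ℝ :=
  fun k j => γ * (marginal (kernelTensor C γ U) k j / kernelSum C γ U - q k j)

/-- The squared Euclidean norm of one block. -/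
def blockSq (g : Vecs m n ℝ) (k : Fin m) : ℝ := ∑ j, g k j ^ 2

/-- The primal tensor reconstructed from a dual point. -/
def primalOf (C : Tensor m n ℝ) (γ : ℝ) (U : Vecs m n ℝ) : Tensor m n ℝ :=
  fun i => kernelTensor C γ U i / kernelSum C γ U

/-- Exact minimization of the dual objective over block `I`, starting from `U`. -/
def blockMin (C : Tensor m n ℝ) (γ : ℝ) (q U : Vecs m n ℝ) (I : Fin m) : Vecs m n ℝ :=
  fun k j => if k = I then
    U k j + Real.log (q k j) - Real.log (marginal (kernelTensor C γ U) k j) else U k j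

/-! ### Primal-dual accelerated alternating minimization -/

/-- The state of the method: dual points `η`, `ζ`, accumulated weight `A`, primal average `X`. -/
structure State (m n : ℕ) (R : Type) where
  η : Vecs m n R
  ζ : Vecs m n R
  A : R
  X : Tensor m n R

/-- The starting state. The entry `X` is never used, since it is weighted by `A = 0`. -/
def State.init (m n : ℕ) : State m n ℝ := ⟨fun _ _ => 0, fun _ _ => 0, 0, fun _ => 0⟩

/-- One step of the method, from `s` to `s'`, with any choice of the line-search minimizer `β` and
of the block `I` with the largest partial gradient. When the gradient vanishes at `θ`, every weight
`a` solves the quadratic equation; the step then takes `a = +∞`, that is, the new primal average is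
the tensor reconstructed from `θ` (and `A`, `ζ` are kept). -/
def Step (C : Tensor m n ℝ) (γ : ℝ) (q : Vecs m n ℝ) (s s' : State m n ℝ) : Prop :=
  ∃ (β : ℝ) (θ : Vecs m n ℝ) (I : Fin m),
    IsMinOn (fun b : ℝ => dualObj C γ q (s.η + b • (s.ζ - s.η))) (Set.Icc 0 1) β ∧
    β ∈ Set.Icc (0 : ℝ) 1 ∧
    θ = s.η + β • (s.ζ - s.η) ∧
    (∀ k, blockSq (dualGrad C γ q θ) k ≤ blockSq (dualGrad C γ q θ) I) ∧
    s'.η = blockMin C γ q θ I ∧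
    (dualGrad C γ q θ ≠ 0 → ∃ a : ℝ,
      IsGreatest {a : ℝ | dualObj C γ q θ
        - a ^ 2 / (2 * (s.A + a)) * ∑ k, blockSq (dualGrad C γ q θ) k = dualObj C γ q s'.η} a ∧
      s'.A = s.A + a ∧
      s'.ζ = s.ζ - a • dualGrad C γ q θ ∧
      s'.X = fun i => (a * primalOf C γ θ i + s.A * s.X i) / s'.A) ∧
    (dualGrad C γ q θ = 0 → s'.A = s.A ∧ s'.ζ = s.ζ ∧ s'.X = primalOf C γ θ)

/-! ### Multimarginal rounding -/

/-- Scale the slices of `V` in direction `r` so that the `r`-th marginal is at most `p r`. -/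
def scaleDir (p : Vecs m n ℝ) (V : Tensor m n ℝ) (r : Fin m) : Tensor m n ℝ :=
  fun i => V i * min (p r (i r) / marginal V r (i r)) 1

/-- The tensor after scaling in all directions `1, …, m`, one after the other. -/
def scaled (p : Vecs m n ℝ) (V : Tensor m n ℝ) : Tensor m n ℝ :=
  (List.finRange m).foldl (scaleDir p) V

/-- The last of the `m` directions. -/
def lastDir (m : ℕ) [NeZero m] : Fin m := ⟨m - 1, Nat.sub_lt (NeZero.pos m) one_pos⟩

/-- The rounding procedure: scale, then add the normalized tensor product of the marginal defects.
If the defects vanish, the added tensor is zero. -/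
def rounding [NeZero m] (p : Vecs m n ℝ) (V : Tensor m n ℝ) : Tensor m n ℝ :=
  let W := scaled p V
  let err : Vecs m n ℝ := fun k j => p k j - marginal W k j
  fun i => W i + (∏ k, err k (i k)) / (∑ j, |err (lastDir m) j|) ^ (m - 1)

/-! ### The complete method -/

/-- The regularization parameter. -/
def gammaOf (m n : ℕ) (ε : ℝ) : ℝ := ε / (2 * m * Real.log n)

/-- The auxiliary accuracy `ε'`. -/
def epsOf (C : Tensor m n ℝ) (ε : ℝ) : ℝ := ε / (8 * ‖C‖)

/-- The perturbed marginals. -/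
def perturbed (C : Tensor m n ℝ) (p : Vecs m n ℝ) (ε : ℝ) : Vecs m n ℝ :=
  fun k j => (1 - epsOf C ε / (4 * m)) * p k j + epsOf C ε / (4 * m * n)

/-- The stopping test. -/
def Stop (C : Tensor m n ℝ) (p : Vecs m n ℝ) (ε : ℝ) (s : State m n ℝ) : Prop :=
  2 * ‖C‖ * (∑ k, ∑ j, |marginal s.X k j - perturbed C p ε k j|)
    + primalObj C (gammaOf m n ε) s.X + dualObj C (gammaOf m n ε) (perturbed C p ε) s.η
    ≤ 3 * ε / 8

/-- A sequence of states generated by the method. -/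
def IsRun (C : Tensor m n ℝ) (p : Vecs m n ℝ) (ε : ℝ) (s : ℕ → State m n ℝ) : Prop :=
  s 0 = State.init m n ∧
    ∀ t, Step C (gammaOf m n ε) (perturbed C p ε) (s t) (s (t + 1))

/-- `T ≥ 1` is the first iteration after which the stopping test succeeds. -/
def StopsAt (C : Tensor m n ℝ) (p : Vecs m n ℝ) (ε : ℝ) (s : ℕ → State m n ℝ) (T : ℕ) : Prop :=
  IsLeast {t | 1 ≤ t ∧ Stop C p ε (s t)} T

/-! ### Counting arithmetic operations -/

/-- The result of a computation with the number of operations performed. -/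
structure Counted (α : Type) where
  val : α
  ops : ℕ

instance : Monad Counted where
  pure a := ⟨a, 0⟩
  bind x f := ⟨(f x.val).val, x.ops + (f x.val).ops⟩

/-- Fill an array indexed by `ι`, paying for the computation of all its entries. -/
def tabulate {ι α : Type} [Fintype ι] (f : ι → Counted α) : Counted (ι → α) :=
  ⟨fun i => (f i).val, ∑ i, (f i).ops⟩

/-- The operations available to a program. Programs are written for an arbitrary type `R` of
numbers, so that these are the only operations on numbers that they can use. -/
structure Machine (m n : ℕ) (R : Type) where
  const : ℕ → Counted R
  add : R → R → Counted R
  sub : R → R → Counted R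
  mul : R → R → Counted R
  div : R → R → Counted R
  max : R → R → Counted R
  min : R → R → Counted R
  abs : R → Counted R
  exp : R → Counted R
  log : R → Counted R
  sqrt : R → Counted R
  le : R → R → Counted Bool
  lineMin : Tensor m n R → Tensor m n R → R → Counted R

/-- `ls a b c` minimizes `log ∑ᵢ exp (aᵢ + β bᵢ) - β c` over `β ∈ [0, 1]`, for all data. -/
def IsExactLineSearch (ls : Tensor m n ℝ → Tensor m n ℝ → ℝ → ℝ) : Prop :=
  ∀ a b c, ls a b c ∈ Set.Icc (0 : ℝ) 1 ∧
    IsMinOn (fun β : ℝ => Real.log (∑ i, Real.exp (a i + β * b i)) - β * c)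
      (Set.Icc 0 1) (ls a b c)

/-- Exact real arithmetic at unit cost per operation. A line search is charged one operation for
each of the `2 n ^ m + 1` numbers it is given. -/
def realMachine (ls : Tensor m n ℝ → Tensor m n ℝ → ℝ → ℝ) : Machine m n ℝ where
  const k := ⟨k, 1⟩
  add x y := ⟨x + y, 1⟩
  sub x y := ⟨x - y, 1⟩
  mul x y := ⟨x * y, 1⟩
  div x y := ⟨x / y, 1⟩
  max x y := ⟨x ⊔ y, 1⟩
  min x y := ⟨x ⊓ y, 1⟩
  abs x := ⟨|x|, 1⟩
  exp x := ⟨Real.exp x, 1⟩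
  log x := ⟨Real.log x, 1⟩
  sqrt x := ⟨Real.sqrt x, 1⟩
  le x y := ⟨decide (x ≤ y), 1⟩
  lineMin a b c := ⟨ls a b c, 2 * n ^ m + 1⟩

/-! ### The method as a program -/

namespace Machine

variable {R : Type} (M : Machine m n R)

/-- Summation loop. -/
def sum {ι : Type} (s : Finset ι) (f : ι → Counted R) : Counted R := do
  let z ← M.const 0
  s.toList.foldlM (fun acc i => do
    let x ← f i
    M.add acc x) z

/-- Multiplication loop. -/
def prod {ι : Type} (s : Finset ι) (f : ι → Counted R) : Counted R := do
  let z ← M.const 1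
  s.toList.foldlM (fun acc i => do
    let x ← f i
    M.mul acc x) z

/-- All marginals in one direction. -/
def marginalDir (X : Tensor m n R) (k : Fin m) : Counted (Fin n → R) :=
  tabulate fun j =>
    M.sum (univ.filter (fun i : Fin m → Fin n => i k = j)) fun i => pure (X i)

/-- The marginals in all directions. -/
def marginals (X : Tensor m n R) : Counted (Vecs m n R) :=
  tabulate fun k => M.marginalDir X k

/-- The tensor with entries `∑ₖ uₖ(iₖ)`. -/
def tensorSum (u : Vecs m n R) : Counted (Tensor m n R) :=
  tabulate fun i => M.sum univ fun k => pure (u k (i k))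

/-- The inner product of two families of vectors. -/
def dot (u v : Vecs m n R) : Counted R :=
  M.sum univ fun k => M.sum univ fun j => M.mul (u k j) (v k j)

/-- The sum of the entries of a tensor. -/
def total (X : Tensor m n R) : Counted R := M.sum univ fun i => pure (X i)

/-- The largest absolute value of an entry. -/
def supNorm (X : Tensor m n R) : Counted R := do
  let z ← M.const 0
  (univ : Finset (Fin m → Fin n)).toList.foldlM (fun acc i => do
    let x ← M.abs (X i)
    M.max acc x) z

/-- Data computed once, before the first iteration. -/
structure Setup (m n : ℕ) (R : Type) where
  C : Tensor m n R
  γ : R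
  normC : R
  q : Vecs m n R
  Cγ : Tensor m n R
  threshold : R

/-- Computation of the regularization parameter, the perturbed marginals and the threshold. -/
def setup (C : Tensor m n R) (p : Vecs m n R) (ε : R) : Counted (Setup m n R) := do
  let normC ← M.supNorm C
  let one ← M.const 1
  let two ← M.const 2
  let three ← M.const 3
  let four ← M.const 4
  let eight ← M.const 8
  let mR ← M.const m
  let nR ← M.const n
  let twoM ← M.mul two mR
  let logN ← M.log nR
  let den ← M.mul twoM logN
  let γ ← M.div ε den
  let den' ← M.mul eight normC
  let ε' ← M.div ε den'
  let fourM ← M.mul four mR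
  let w ← M.div ε' fourM
  let w' ← M.sub one w
  let fourMN ← M.mul fourM nR
  let e ← M.div ε' fourMN
  let q ← tabulate fun k => tabulate fun j => do
    let x ← M.mul w' (p k j)
    M.add x e
  let Cγ ← tabulate fun i => M.div (C i) γ
  let threeE ← M.mul three ε
  let threshold ← M.div threeE eight
  pure ⟨C, γ, normC, q, Cγ, threshold⟩

/-- The tensor `B(u)`. -/
def kernel (E : Setup m n R) (u : Vecs m n R) : Counted (Tensor m n R) := do
  let S ← M.tensorSum u
  tabulate fun i => do
    let x ← M.sub (S i) (E.Cγ i)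
    M.exp x

/-- The dual objective at `u`, given the sum `σ` of the entries of `B(u)`. -/
def dualValue (E : Setup m n R) (σ : R) (u : Vecs m n R) : Counted R := do
  let l ← M.log σ
  let d ← M.dot u E.q
  let x ← M.sub l d
  M.mul E.γ x

/-- A block with the largest value, found by comparing the blocks one after the other. -/
def argmax [NeZero m] (f : Fin m → R) : Counted (Fin m) :=
  (List.finRange m).foldlM (fun best k => do
    let b ← M.le (f k) (f best)
    pure (if b then best else k)) 0

/-- The stopping test for a primal tensor `X`, given the current dual value `v`. -/
def stopTest (E : Setup m n R) (X : Tensor m n R) (v : R) : Counted Bool := do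
  let P ← M.marginals X
  let d ← M.sum univ fun k => M.sum univ fun j => do
    let x ← M.sub (P k j) (E.q k j)
    M.abs x
  let two ← M.const 2
  let c ← M.mul two E.normC
  let d' ← M.mul c d
  let lin ← M.sum univ fun i => M.mul (E.C i) (X i)
  let ent ← M.sum univ fun i => do
    let l ← M.log (X i)
    M.mul (X i) l
  let ent' ← M.mul E.γ ent
  let F ← M.add lin ent'
  let x ← M.add d' F
  let y ← M.add x v
  M.le y E.threshold

/-- One iteration: the new state, and whether the stopping test succeeds for it. -/
def iteration [NeZero m] (E : Setup m n R) (s : State m n R) : Counted (State m n R × Bool) := do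
  -- line search
  let d ← tabulate fun k => tabulate fun j => M.sub (s.ζ k j) (s.η k j)
  let a₀ ← M.tensorSum s.η
  let a ← tabulate fun i => M.sub (a₀ i) (E.Cγ i)
  let b ← M.tensorSum d
  let c ← M.dot d E.q
  let β ← M.lineMin a b c
  let θ ← tabulate fun k => tabulate fun j => do
    let x ← M.mul β (d k j)
    M.add (s.η k j) x
  -- gradient
  let B ← M.kernel E θ
  let σ ← M.total B
  let P ← M.marginals B
  let g ← tabulate fun k => tabulate fun j => do
    let x ← M.div (P k j) σ
    let y ← M.sub x (E.q k j)
    M.mul E.γ y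
  let sq ← tabulate fun k => M.sum univ fun j => M.mul (g k j) (g k j)
  let G ← M.sum univ fun k => pure (sq k)
  -- block minimization
  let I ← M.argmax sq
  let blk ← tabulate fun j => do
    let x ← M.log (E.q I j)
    let y ← M.log (P I j)
    let z ← M.add (θ I j) x
    M.sub z y
  let η' : Vecs m n R := fun k j => if k = I then blk j else θ k j
  let B' ← M.kernel E η'
  let σ' ← M.total B'
  let vθ ← M.dualValue E σ θ
  let v ← M.dualValue E σ' η'
  let xθ ← tabulate fun i => M.div (B i) σ
  let zero ← M.const 0
  let flat ← M.le G zero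
  if flat then do
    let halt ← M.stopTest E xθ v
    pure (⟨η', s.ζ, s.A, xθ⟩, halt)
  else do
    -- the larger root of the quadratic equation
    let D ← M.sub vθ v
    let DD ← M.mul D D
    let DA ← M.mul D s.A
    let DAG ← M.mul DA G
    let twoDAG ← M.add DAG DAG
    let disc ← M.add DD twoDAG
    let r ← M.sqrt disc
    let num ← M.add D r
    let w ← M.div num G
    let A' ← M.add s.A w
    let ζ' ← tabulate fun k => tabulate fun j => do
      let x ← M.mul w (g k j)
      M.sub (s.ζ k j) x
    let X' ← tabulate fun i => do
      let x ← M.mul w (xθ i)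
      let y ← M.mul s.A (s.X i)
      let z ← M.add x y
      M.div z A'
    let halt ← M.stopTest E X' v
    pure (⟨η', ζ', A', X'⟩, halt)

/-- The starting state. -/
def start : Counted (State m n R) := do
  let z ← M.const 0
  pure ⟨fun _ _ => z, fun _ _ => z, z, fun _ => z⟩

/-- The rounding procedure. -/
def round [NeZero m] (p : Vecs m n R) (V : Tensor m n R) : Counted (Tensor m n R) := do
  let one ← M.const 1
  let W ← (List.finRange m).foldlM (fun V r => do
    let P ← M.marginalDir V r
    let x ← tabulate fun j => do
      let y ← M.div (p r j) (P j)
      M.min y one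
    tabulate fun i => M.mul (V i) (x (i r))) V
  let P ← M.marginals W
  let err ← tabulate fun k => tabulate fun j => M.sub (p k j) (P k j)
  let e ← M.sum univ fun j => M.abs (err (lastDir m) j)
  let den ← M.prod (univ : Finset (Fin (m - 1))) fun _ => pure e
  tabulate fun i => do
    let num ← M.prod univ fun k => pure (err k (i k))
    let x ← M.div num den
    M.add (W i) x

end Machine

/-- `RepeatUntil body s s' T N`: repeating `body` from the state `s` until its test succeeds takes
`T` iterations and `N` operations, and ends in the state `s'`. -/
inductive RepeatUntil {σ : Type} (body : σ → Counted (σ × Bool)) : σ → σ → ℕ → ℕ → Prop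
  | last (s : σ) (h : (body s).val.2 = true) :
      RepeatUntil body s (body s).val.1 1 (body s).ops
  | next (s s' : σ) (T N : ℕ) (h : (body s).val.2 = false)
      (hr : RepeatUntil body (body s).val.1 s' T N) :
      RepeatUntil body s s' (T + 1) ((body s).ops + N)

/-- On the input `C`, `p`, `ε`, the complete program halts after `T` iterations and `N` operations
in total (preparation, iterations and rounding) with output `X`. -/
def Executes [NeZero m] (M : Machine m n ℝ) (C : Tensor m n ℝ) (p : Vecs m n ℝ) (ε : ℝ)
    (X : Tensor m n ℝ) (T N : ℕ) : Prop :=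
  ∃ (s : State m n ℝ) (k : ℕ),
    RepeatUntil (M.iteration (M.setup C p ε).val) M.start.val s T k ∧
    X = (M.round p s.X).val ∧
    N = (M.setup C p ε).ops + M.start.ops + k + (M.round p s.X).ops

end MOT

end

namespace MOT

variable {m n : ℕ}

/-! ### Marginals and pairings -/

/-! The dual `φ` is minimized by accelerated alternating minimization, and a duality gap is tracked
along the way. Three facts carry the convergence.

Exact minimization over a block `I` decreases `φ` by `γ` times the relative entropy of `q_I` from
the current marginal (`dualObj_sub_blockMin`), and that relative entropy is at least half the
squared Euclidean distance. Hence the squared block gradient is at most `2γ` times the decrease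
(`blockSq_le_dualObj_sub`). For the largest block, the full squared gradient is at most `2γm` times
the decrease. This plays the role of smoothness with constant `γm`, and forces the weights to
satisfy `A' ≤ γ m a²`, so `A_t ≥ t² / (4γm)` (`AcceleratedStep.sqrt_growth`).

The logarithm of `X(U)` is affine in `U`, so `F(X(U)) = ⟨∇φ(U), U⟩ - φ(U)` (`primalObj_primalOf`).
Together with convexity of `F` and optimality of the line search, this propagates the
estimate-sequence inequality (`AcceleratedStep.estimate`). Testing that inequality with a vector of
signs bounds the weighted infeasibility plus duality gap by a multiple of `1 / A_t`
(`Estimate.gap_le`). A step with vanishing gradient closes the gap at once.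

When the test succeeds, weak duality, the entropy bounds and the cost of rounding
(`neg_dualObj_le_primalObj`, `rounding_spec`) certify an approximate solution
(`Stop.isApproxSolution`). For the complexity, each iteration of the program is shown to be a
legitimate step (`Machine.iteration_spec`) of cost `O(m n^m)`, and the costs are added up. -/

theorem sum_marginal_mul (X : Tensor m n ℝ) (k : Fin m) (u : Fin n → ℝ) :
    ∑ j, marginal X k j * u j = ∑ i, X i * u (i k) := by
  unfold marginal
  rw [← Finset.sum_fiberwise univ (fun i : Fin m → Fin n => i k) (fun i => X i * u (i k))]
  refine sum_congr rfl fun j _ => ?_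
  rw [sum_mul]
  refine sum_congr rfl fun i hi => ?_
  rw [(mem_filter.1 hi).2]

theorem sum_marginal (X : Tensor m n ℝ) (k : Fin m) : ∑ j, marginal X k j = ∑ i, X i := by
  simpa using sum_marginal_mul X k (fun _ => 1)

theorem marginal_nonneg {X : Tensor m n ℝ} (hX : ∀ i, 0 ≤ X i) (k : Fin m) (j : Fin n) :
    0 ≤ marginal X k j := sum_nonneg fun i _ => hX i

theorem marginal_mono {X Y : Tensor m n ℝ} (h : ∀ i, X i ≤ Y i) (k : Fin m) (j : Fin n) :
    marginal X k j ≤ marginal Y k j := sum_le_sum fun i _ => h i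

theorem marginal_add (X Y : Tensor m n ℝ) (k : Fin m) (j : Fin n) :
    marginal (fun i => X i + Y i) k j = marginal X k j + marginal Y k j := sum_add_distrib

theorem marginal_const_mul (c : ℝ) (X : Tensor m n ℝ) (k : Fin m) (j : Fin n) :
    marginal (fun i => c * X i) k j = c * marginal X k j := (mul_sum _ _ _).symm

theorem marginal_div_const (c : ℝ) (X : Tensor m n ℝ) (k : Fin m) (j : Fin n) :
    marginal (fun i => X i / c) k j = marginal X k j / c := (sum_div _ _ _).symm

/-- The Euclidean inner product of two families of vectors. -/
noncomputable def pairing (u v : Vecs m n ℝ) : ℝ := ∑ k, ∑ j, u k j * v k j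

theorem pairing_comm (u v : Vecs m n ℝ) : pairing u v = pairing v u := by
  simp only [pairing, mul_comm]

theorem pairing_add_right (u v w : Vecs m n ℝ) :
    pairing u (v + w) = pairing u v + pairing u w := by
  simp only [pairing, Pi.add_apply, mul_add, sum_add_distrib]

theorem pairing_sub_right (u v w : Vecs m n ℝ) :
    pairing u (v - w) = pairing u v - pairing u w := by
  simp only [pairing, Pi.sub_apply, mul_sub, sum_sub_distrib]

theorem pairing_smul_right (c : ℝ) (u v : Vecs m n ℝ) :
    pairing u (c • v) = c * pairing u v := by
  simp only [pairing, Pi.smul_apply, smul_eq_mul, mul_sum]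
  exact sum_congr rfl fun k _ => sum_congr rfl fun j _ => by ring

theorem pairing_add_left (u v w : Vecs m n ℝ) :
    pairing (u + v) w = pairing u w + pairing v w := by
  rw [pairing_comm, pairing_add_right, pairing_comm w u, pairing_comm w v]

theorem pairing_smul_left (c : ℝ) (u v : Vecs m n ℝ) :
    pairing (c • u) v = c * pairing u v := by
  rw [pairing_comm, pairing_smul_right, pairing_comm]

theorem pairing_self (u : Vecs m n ℝ) : pairing u u = ∑ k, blockSq u k := by
  simp only [pairing, blockSq, sq]

theorem pairing_marginal (X : Tensor m n ℝ) (u : Vecs m n ℝ) :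
    pairing (marginal X) u = ∑ i, X i * ∑ k, u k (i k) := by
  simp only [pairing, sum_marginal_mul, mul_sum]
  exact sum_comm

theorem sum_blockSq_eq_zero {g : Vecs m n ℝ} : ∑ k, blockSq g k = 0 ↔ g = 0 := by
  have h0 : ∀ k ∈ (univ : Finset (Fin m)), 0 ≤ blockSq g k :=
    fun _ _ => sum_nonneg fun _ _ => sq_nonneg _
  constructor
  · intro h
    rw [sum_eq_zero_iff_of_nonneg h0] at h
    funext k j
    have h1 := h k (mem_univ k)
    rw [blockSq, sum_eq_zero_iff_of_nonneg fun j _ => sq_nonneg _] at h1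
    exact pow_eq_zero_iff two_ne_zero |>.1 (h1 j (mem_univ j))
  · rintro rfl
    simp [blockSq]

theorem sum_blockSq_nonneg (g : Vecs m n ℝ) : 0 ≤ ∑ k, blockSq g k :=
  sum_nonneg fun _ _ => sum_nonneg fun _ _ => sq_nonneg _

/-! ### The dual objective -/

theorem kernelTensor_pos (C : Tensor m n ℝ) (γ : ℝ) (U : Vecs m n ℝ) (i : Fin m → Fin n) :
    0 < kernelTensor C γ U i := Real.exp_pos _

theorem kernelSum_pos [NeZero n] (C : Tensor m n ℝ) (γ : ℝ) (U : Vecs m n ℝ) :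
    0 < kernelSum C γ U :=
  sum_pos (fun i _ => kernelTensor_pos C γ U i) univ_nonempty

theorem marginal_kernelTensor_pos (C : Tensor m n ℝ) (γ : ℝ) (U : Vecs m n ℝ) (k : Fin m)
    (j : Fin n) : 0 < marginal (kernelTensor C γ U) k j :=
  sum_pos (fun i _ => kernelTensor_pos C γ U i) ⟨fun _ => j, by simp⟩

theorem primalOf_pos [NeZero n] (C : Tensor m n ℝ) (γ : ℝ) (U : Vecs m n ℝ)
    (i : Fin m → Fin n) : 0 < primalOf C γ U i :=
  div_pos (kernelTensor_pos C γ U i) (kernelSum_pos C γ U)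

theorem sum_primalOf [NeZero n] (C : Tensor m n ℝ) (γ : ℝ) (U : Vecs m n ℝ) :
    ∑ i, primalOf C γ U i = 1 := by
  unfold primalOf
  rw [← sum_div]
  exact div_self (kernelSum_pos C γ U).ne'

theorem marginal_primalOf (C : Tensor m n ℝ) (γ : ℝ) (U : Vecs m n ℝ) (k : Fin m) (j : Fin n) :
    marginal (primalOf C γ U) k j = marginal (kernelTensor C γ U) k j / kernelSum C γ U :=
  marginal_div_const _ _ _ _

theorem dualGrad_eq (C : Tensor m n ℝ) (γ : ℝ) (q U : Vecs m n ℝ) :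
    dualGrad C γ q U = γ • (marginal (primalOf C γ U) - q) := by
  funext k j
  simp [dualGrad, marginal_primalOf]

theorem dualObj_eq (C : Tensor m n ℝ) (γ : ℝ) (q U : Vecs m n ℝ) :
    dualObj C γ q U = γ * (Real.log (kernelSum C γ U) - pairing U q) := rfl

theorem log_primalOf [NeZero n] (C : Tensor m n ℝ) (γ : ℝ) (U : Vecs m n ℝ)
    (i : Fin m → Fin n) :
    Real.log (primalOf C γ U i) = ∑ k, U k (i k) - C i / γ - Real.log (kernelSum C γ U) := by
  rw [primalOf, Real.log_div (kernelTensor_pos C γ U i).ne' (kernelSum_pos C γ U).ne',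
    kernelTensor, Real.log_exp]

/-- Substituting `log X(U) = ∑ U - C/γ - log Σ(U)` into the entropy cancels the transport cost; what
remains is linear in the marginals of `X(U)`, apart from `log Σ(U)`. -/
theorem primalObj_primalOf [NeZero n] (C : Tensor m n ℝ) {γ : ℝ} (hγ : 0 < γ)
    (q U : Vecs m n ℝ) :
    primalObj C γ (primalOf C γ U) = pairing (dualGrad C γ q U) U - dualObj C γ q U := by
  have h : ∀ i, primalOf C γ U i * Real.log (primalOf C γ U i)
      = primalOf C γ U i * ∑ k, U k (i k) - C i * primalOf C γ U i / γ
        - primalOf C γ U i * Real.log (kernelSum C γ U) := by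
    intro i
    rw [log_primalOf]
    ring
  have hc : pairing (marginal (primalOf C γ U) - q) U
      = pairing (marginal (primalOf C γ U)) U - pairing U q := by
    rw [pairing_comm, pairing_sub_right, pairing_comm U]
  rw [dualGrad_eq, pairing_smul_left, hc, dualObj_eq, primalObj, cost]
  simp only [h, sum_sub_distrib]
  rw [← sum_div, ← sum_mul, sum_primalOf, pairing_marginal]
  field_simp
  ring

theorem hasDerivAt_dualObj_line [NeZero n] (C : Tensor m n ℝ) (γ : ℝ) (q U D : Vecs m n ℝ)
    (β : ℝ) :
    HasDerivAt (fun b : ℝ => dualObj C γ q (U + b • D))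
      (pairing (dualGrad C γ q (U + β • D)) D) β := by
  have hk : ∀ i, HasDerivAt (fun b : ℝ => kernelTensor C γ (U + b • D) i)
      (kernelTensor C γ (U + β • D) i * ∑ k, D k (i k)) β := by
    intro i
    have h1 : HasDerivAt (fun b : ℝ => ∑ k, (U + b • D) k (i k) - C i / γ)
        (∑ k, D k (i k)) β := by
      refine HasDerivAt.sub_const _ (HasDerivAt.fun_sum fun k _ => ?_)
      simpa using ((hasDerivAt_id β).mul_const (D k (i k))).const_add (U k (i k))
    exact h1.exp
  have hs : HasDerivAt (fun b : ℝ => kernelSum C γ (U + b • D))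
      (∑ i, kernelTensor C γ (U + β • D) i * ∑ k, D k (i k)) β :=
    HasDerivAt.fun_sum fun i _ => hk i
  have hp : HasDerivAt (fun b : ℝ => pairing (U + b • D) q) (pairing D q) β := by
    simp only [pairing_add_left, pairing_smul_left]
    simpa using ((hasDerivAt_id β).mul_const (pairing D q)).const_add (pairing U q)
  have hl := ((hs.log (kernelSum_pos C γ (U + β • D)).ne').sub hp).const_mul γ
  have he : pairing (dualGrad C γ q (U + β • D)) D
      = γ * ((∑ i, kernelTensor C γ (U + β • D) i * ∑ k, D k (i k)) / kernelSum C γ (U + β • D)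
        - pairing D q) := by
    rw [dualGrad_eq, pairing_smul_left, pairing_comm, pairing_sub_right, pairing_comm D,
      pairing_marginal]
    simp only [primalOf, div_mul_eq_mul_div, sum_div]
  rw [he]
  exact hl

/-! ### Exact minimization over one block -/

/-- A pointwise form of a Pinsker-type inequality. Summed over two probability vectors the terms `-q
+ p` cancel, which leaves the relative entropy above half the squared Euclidean distance. -/
theorem half_sq_sub_le_kl {p q : ℝ} (hp : 0 < p) (hp1 : p ≤ 1) (hq : 0 < q) (hq1 : q ≤ 1) :
    (q - p) ^ 2 / 2 ≤ q * (Real.log q - Real.log p) - q + p := by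
  obtain ⟨x, hx, rfl⟩ : ∃ x, 0 < x ∧ p = q * x := ⟨p / q, div_pos hp hq, by field_simp⟩
  rw [Real.log_mul hq.ne' hx.ne']
  rcases le_total x 1 with h | h
  -- For `x ≤ 1`, two terms of the series of `-log (1 - (1 - x))` give `-log x ≥ (1 - x) + (1 - x)²
  -- / 2`; then `q ≤ 1` turns `q` into `q²`.
  · have hs := Real.hasSum_pow_div_log_of_abs_lt_one (x := 1 - x)
      (by rw [abs_lt]; constructor <;> linarith)
    have h2 := sum_le_hasSum (range 2) (fun i _ => by
      have : 0 ≤ 1 - x := by linarith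
      positivity) hs
    simp only [sum_range_succ, sum_range_zero, sub_sub_cancel] at h2
    norm_num at h2
    nlinarith [mul_le_mul_of_nonneg_left h2 hq.le, mul_nonneg hq.le (sq_nonneg (1 - x)),
      mul_nonneg (mul_nonneg hq.le (sub_nonneg.2 hq1)) (sq_nonneg (1 - x))]
  -- For `x ≥ 1`, `log x ≤ sinh (log x) = (x - 1/x) / 2`, and the remainder is `q (1 - x)² / (2x)`.
  -- Here `p = q x ≤ 1` is what gives `q² ≤ q / x`.
  · have h2 := Real.self_le_sinh_iff.2 (Real.log_nonneg h)
    rw [Real.sinh_log hx] at h2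
    have h3 : q * Real.log x ≤ q * ((x - x⁻¹) / 2) := mul_le_mul_of_nonneg_left h2 hq.le
    have h4 : q ^ 2 * (1 - x) ^ 2 / 2 ≤ q * (1 - x) ^ 2 / (2 * x) := by
      rw [div_le_div_iff₀ two_pos (by positivity)]
      nlinarith [mul_nonneg (mul_nonneg hq.le (sub_nonneg.2 hp1)) (sq_nonneg (1 - x))]
    have h5 : q * (1 - x) ^ 2 / (2 * x) = -(q * ((x - x⁻¹) / 2)) - q + q * x := by
      field_simp
      ring
    nlinarith

/-- The update multiplies each slice in direction `I` by `q_I / p_I(B)`, so the new tensor has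
`I`-th marginal exactly `q_I`, of total mass 1. -/
theorem kernelSum_blockMin {C : Tensor m n ℝ} {γ : ℝ} {q : Vecs m n ℝ} (hq : ∀ k j, 0 < q k j)
    (hq1 : ∀ k, ∑ j, q k j = 1) (U : Vecs m n ℝ) (I : Fin m) :
    kernelSum C γ (blockMin C γ q U I) = 1 := by
  have hP := marginal_kernelTensor_pos C γ U I
  have h : ∀ i, kernelTensor C γ (blockMin C γ q U I) i = kernelTensor C γ U i *
      (q I (i I) / marginal (kernelTensor C γ U) I (i I)) := by
    intro i
    have hs : ∑ k, blockMin C γ q U I k (i k) = ∑ k, U k (i k) +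
        (Real.log (q I (i I)) - Real.log (marginal (kernelTensor C γ U) I (i I))) := by
      rw [← Finset.add_sum_erase _ _ (mem_univ I), ← Finset.add_sum_erase univ _ (mem_univ I)]
      have : ∑ k ∈ univ.erase I, blockMin C γ q U I k (i k) = ∑ k ∈ univ.erase I, U k (i k) :=
        sum_congr rfl fun k hk => by simp [blockMin, (mem_erase.1 hk).1]
      rw [this]
      simp only [blockMin, if_true]
      ring
    rw [kernelTensor, hs, ← Real.log_div (hq _ _).ne' (hP _).ne', add_sub_right_comm, Real.exp_add,
      Real.exp_log (div_pos (hq _ _) (hP _))]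
    rfl
  rw [kernelSum, sum_congr rfl fun i _ => h i,
    ← sum_marginal_mul _ I fun j => q I j / marginal (kernelTensor C γ U) I j, ← hq1 I]
  exact sum_congr rfl fun j _ => mul_div_cancel₀ _ (hP j).ne'

theorem dualObj_sub_blockMin [NeZero n] {C : Tensor m n ℝ} {γ : ℝ} {q : Vecs m n ℝ}
    (hq : ∀ k j, 0 < q k j) (hq1 : ∀ k, ∑ j, q k j = 1) (U : Vecs m n ℝ) (I : Fin m) :
    dualObj C γ q U - dualObj C γ q (blockMin C γ q U I)
      = γ * ∑ j, q I j * (Real.log (q I j) - Real.log (marginal (primalOf C γ U) I j)) := by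
  have hσ := kernelSum_pos C γ U
  have hp : pairing (blockMin C γ q U I) q = pairing U q + ∑ j, q I j *
      (Real.log (q I j) - Real.log (marginal (kernelTensor C γ U) I j)) := by
    unfold pairing
    rw [← Finset.add_sum_erase _ _ (mem_univ I), ← Finset.add_sum_erase univ _ (mem_univ I)]
    have : ∑ k ∈ univ.erase I, ∑ j, blockMin C γ q U I k j * q k j
        = ∑ k ∈ univ.erase I, ∑ j, U k j * q k j :=
      sum_congr rfl fun k hk => by simp [blockMin, (mem_erase.1 hk).1]
    rw [this]
    simp only [blockMin, if_true]
    rw [add_right_comm, ← sum_add_distrib]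
    congr 1
    exact sum_congr rfl fun j _ => by ring
  have hl : ∀ j, q I j * (Real.log (q I j) - Real.log (marginal (primalOf C γ U) I j))
      = q I j * (Real.log (q I j) - Real.log (marginal (kernelTensor C γ U) I j))
        + q I j * Real.log (kernelSum C γ U) := by
    intro j
    rw [marginal_primalOf, Real.log_div (marginal_kernelTensor_pos C γ U I j).ne' hσ.ne']
    ring
  simp only [hl, sum_add_distrib, ← sum_mul, hq1]
  rw [dualObj_eq, dualObj_eq, kernelSum_blockMin hq hq1, hp, Real.log_one]
  ring

/-- The substitute for a Lipschitz gradient: the decrease is `γ` times a relative entropy, the block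
gradient is `γ` times a difference of marginals, and `half_sq_sub_le_kl` compares the two. -/
theorem blockSq_le_dualObj_sub [NeZero n] {C : Tensor m n ℝ} {γ : ℝ}
    {q : Vecs m n ℝ} (hq : ∀ k j, 0 < q k j) (hq1 : ∀ k, ∑ j, q k j = 1) (U : Vecs m n ℝ)
    (I : Fin m) :
    blockSq (dualGrad C γ q U) I
      ≤ 2 * γ * (dualObj C γ q U - dualObj C γ q (blockMin C γ q U I)) := by
  set P := marginal (primalOf C γ U) I with hP
  have hPpos : ∀ j, 0 < P j := fun j => by
    rw [hP, marginal_primalOf]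
    exact div_pos (marginal_kernelTensor_pos C γ U I j) (kernelSum_pos C γ U)
  have hPsum : ∑ j, P j = 1 := by rw [hP, sum_marginal, sum_primalOf]
  have hkl : ∑ j, (q I j - P j) ^ 2 / 2
      ≤ ∑ j, (q I j * (Real.log (q I j) - Real.log (P j)) - q I j + P j) := by
    refine sum_le_sum fun j _ => half_sq_sub_le_kl (hPpos j) ?_ (hq I j) ?_
    · rw [← hPsum]
      exact single_le_sum (fun j _ => (hPpos j).le) (mem_univ j)
    · rw [← hq1 I]
      exact single_le_sum (fun j _ => (hq I j).le) (mem_univ j)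
  rw [sum_add_distrib, sum_sub_distrib, hPsum, hq1, ← sum_div] at hkl
  rw [dualObj_sub_blockMin hq hq1]
  have : blockSq (dualGrad C γ q U) I = γ ^ 2 * ∑ j, (q I j - P j) ^ 2 := by
    rw [dualGrad_eq, blockSq, mul_sum]
    refine sum_congr rfl fun j _ => ?_
    simp only [Pi.smul_apply, Pi.sub_apply, smul_eq_mul, ← hP]
    ring
  rw [this]
  nlinarith [mul_le_mul_of_nonneg_left hkl (sq_nonneg γ)]

theorem dualObj_blockMin_of_dualGrad_eq_zero [NeZero n] {C : Tensor m n ℝ} {γ : ℝ} (hγ : 0 < γ)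
    {q : Vecs m n ℝ} (hq : ∀ k j, 0 < q k j) (hq1 : ∀ k, ∑ j, q k j = 1) {U : Vecs m n ℝ}
    (hg : dualGrad C γ q U = 0) (I : Fin m) :
    marginal (primalOf C γ U) = q ∧ dualObj C γ q (blockMin C γ q U I) = dualObj C γ q U := by
  have h : marginal (primalOf C γ U) = q := by
    rw [dualGrad_eq, smul_eq_zero] at hg
    exact sub_eq_zero.1 (hg.resolve_left hγ.ne')
  refine ⟨h, ?_⟩
  have h2 := dualObj_sub_blockMin (C := C) (γ := γ) hq hq1 U I
  simp only [h, sub_self, mul_zero, sum_const_zero] at h2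
  linarith

/-! ### One step of the method -/

/-- The larger root of the quadratic equation that defines the step weight. -/
theorem isGreatest_weight {A G v v' : ℝ} (hA : 0 ≤ A) (hG : 0 < G) (hv : v' < v) :
    0 < (v - v' + √((v - v') * (v - v') + ((v - v') * A * G + (v - v') * A * G))) / G ∧
    IsGreatest {a : ℝ | v - a ^ 2 / (2 * (A + a)) * G = v'}
      ((v - v' + √((v - v') * (v - v') + ((v - v') * A * G + (v - v') * A * G))) / G) := by
  obtain ⟨D, hD⟩ : ∃ D, D = v - v' := ⟨_, rfl⟩
  have hDpos : 0 < D := by linarith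
  rw [← hD]
  have hdisc : 0 ≤ D * D + (D * A * G + D * A * G) := by positivity
  set R := √(D * D + (D * A * G + D * A * G)) with hR
  have hR2 : R ^ 2 = D * D + (D * A * G + D * A * G) := Real.sq_sqrt hdisc
  have hR0 : 0 ≤ R := Real.sqrt_nonneg _
  have hpos : 0 < (D + R) / G := by positivity
  refine ⟨hpos, ?_, ?_⟩
  · have hne : A + (D + R) / G ≠ 0 := by positivity
    have key : ((D + R) / G) ^ 2 * G = 2 * (A + (D + R) / G) * D := by
      field_simp
      nlinarith
    change v - ((D + R) / G) ^ 2 / (2 * (A + (D + R) / G)) * G = v'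
    rw [div_mul_eq_mul_div, key, mul_div_cancel_left₀ _ (by positivity)]
    linarith
  · intro a ha
    change v - a ^ 2 / (2 * (A + a)) * G = v' at ha
    -- With `A + a = 0` the quotient is `0` by convention, and the equation would read `v = v'`.
    have hne : A + a ≠ 0 := by
      intro h0
      rw [h0] at ha
      simp at ha
      linarith
    have h1 : a ^ 2 / (2 * (A + a)) * G = D := by linarith
    have h2 : a ^ 2 * G = 2 * (A + a) * D := by
      rw [← h1]
      field_simp
    rw [le_div_iff₀ hG]
    -- Completing the square in `G a² - 2 D a - 2 A D = 0`, so every solution has `a G - D ≤ R`.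
    have h3 : (a * G - D) ^ 2 = R ^ 2 := by
      rw [hR2]
      nlinarith
    have := abs_le_of_sq_le_sq' h3.le hR0
    linarith [this.2]

/-- What a step with a nonzero gradient at `θ` achieves. -/
structure AcceleratedStep (C : Tensor m n ℝ) (γ : ℝ) (q : Vecs m n ℝ) (s s' : State m n ℝ)
    (θ : Vecs m n ℝ) (a : ℝ) : Prop where
  weight_pos : 0 < a
  descent : a ^ 2 / 2 * pairing (dualGrad C γ q θ) (dualGrad C γ q θ)
    = s'.A * (dualObj C γ q θ - dualObj C γ q s'.η)
  growth : s'.A ≤ γ * m * a ^ 2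
  le_prev : dualObj C γ q θ ≤ dualObj C γ q s.η
  ascent_dir : 0 ≤ pairing (dualGrad C γ q θ) (s.ζ - θ)
  A_eq : s'.A = s.A + a
  ζ_eq : s'.ζ = s.ζ - a • dualGrad C γ q θ
  X_eq : s'.X = fun i => (a * primalOf C γ θ i + s.A * s.X i) / s'.A

/-- What a step with zero gradient at `θ` achieves. -/
structure FlatStep (C : Tensor m n ℝ) (γ : ℝ) (q : Vecs m n ℝ) (s s' : State m n ℝ)
    (θ : Vecs m n ℝ) : Prop where
  grad_eq : dualGrad C γ q θ = 0
  dual_eq : dualObj C γ q s'.η = dualObj C γ q θ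
  marginal_eq : marginal s'.X = q
  A_eq : s'.A = s.A
  X_eq : s'.X = primalOf C γ θ

/-- Since `ζ - θ = (1 - β)(ζ - η)`, nothing is needed at `β = 1`. For `β < 1` the right derivative
at a minimizer is nonnegative; using only the right side covers `β = 0` as well as the interior. -/
theorem lineSearch_ascent [NeZero n] {C : Tensor m n ℝ} {γ : ℝ} {q η ζ : Vecs m n ℝ} {β : ℝ}
    (hmin : IsMinOn (fun b : ℝ => dualObj C γ q (η + b • (ζ - η))) (Set.Icc 0 1) β)
    (hβ : β ∈ Set.Icc (0 : ℝ) 1) :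
    0 ≤ pairing (dualGrad C γ q (η + β • (ζ - η))) (ζ - (η + β • (ζ - η))) := by
  have h1 : ζ - (η + β • (ζ - η)) = (1 - β) • (ζ - η) := by
    rw [sub_smul, one_smul]
    abel
  rw [h1, pairing_smul_right]
  rcases hβ.2.eq_or_lt with rfl | hlt
  · simp
  refine mul_nonneg (by linarith) ?_
  have hd := hasDerivAt_dualObj_line C γ q η (ζ - η) β
  have hdw := hd.hasDerivWithinAt (s := Set.Ioi β)
  rw [hasDerivWithinAt_iff_tendsto_slope' (by simp)] at hdw
  refine ge_of_tendsto hdw ?_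
  filter_upwards [Ioo_mem_nhdsGT hlt] with b hb
  rw [slope_def_field]
  exact div_nonneg (sub_nonneg.2 (hmin ⟨hβ.1.trans hb.1.le, hb.2.le⟩)) (by linarith [hb.1])

theorem Step.accelerated_or_flat [NeZero n] {C : Tensor m n ℝ} {γ : ℝ} (hγ : 0 < γ)
    {q : Vecs m n ℝ} (hq : ∀ k j, 0 < q k j) (hq1 : ∀ k, ∑ j, q k j = 1) {s s' : State m n ℝ}
    (h : Step C γ q s s') (hA : 0 ≤ s.A) :
    ∃ θ, (∃ a, AcceleratedStep C γ q s s' θ a) ∨ FlatStep C γ q s s' θ := by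
  obtain ⟨β, θ, I, hmin, hβ, hθ, hI, hη, hne, hflat⟩ := h
  refine ⟨θ, ?_⟩
  by_cases hg : dualGrad C γ q θ = 0
  · right
    obtain ⟨h1, -, h3⟩ := hflat hg
    obtain ⟨h4, h5⟩ := dualObj_blockMin_of_dualGrad_eq_zero hγ hq hq1 hg I
    exact ⟨hg, by rw [hη, h5], by rw [h3, h4], h1, h3⟩
  · left
    obtain ⟨a, ha, hA', hζ, hX⟩ := hne hg
    have hG0 : 0 < ∑ k, blockSq (dualGrad C γ q θ) k :=
      lt_of_le_of_ne (sum_blockSq_nonneg _) fun h0 => hg (sum_blockSq_eq_zero.1 h0.symm)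
    have hGm : ∑ k, blockSq (dualGrad C γ q θ) k
        ≤ 2 * γ * m * (dualObj C γ q θ - dualObj C γ q s'.η) := by
      calc ∑ k, blockSq (dualGrad C γ q θ) k ≤ ∑ _k : Fin m, blockSq (dualGrad C γ q θ) I :=
            sum_le_sum fun k _ => hI k
        _ = m * blockSq (dualGrad C γ q θ) I := by simp
        _ ≤ m * (2 * γ * (dualObj C γ q θ - dualObj C γ q s'.η)) := by
            rw [hη]
            exact mul_le_mul_of_nonneg_left (blockSq_le_dualObj_sub hq hq1 θ I) (by positivity)
        _ = _ := by ring
    have hv : dualObj C γ q s'.η < dualObj C γ q θ := by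
      by_contra hcon
      have : 2 * γ * m * (dualObj C γ q θ - dualObj C γ q s'.η) ≤ 0 :=
        mul_nonpos_of_nonneg_of_nonpos (by positivity) (by linarith)
      linarith
    obtain ⟨hr, hgr⟩ := isGreatest_weight hA hG0 hv
    have hapos : 0 < a := by
      rw [ha.unique hgr]
      exact hr
    have hAa : 0 < s.A + a := by linarith
    have hdesc : a ^ 2 / 2 * ∑ k, blockSq (dualGrad C γ q θ) k
        = s'.A * (dualObj C γ q θ - dualObj C γ q s'.η) := by
      have h1 : dualObj C γ q θ - a ^ 2 / (2 * (s.A + a)) * ∑ k, blockSq (dualGrad C γ q θ) k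
        = dualObj C γ q s'.η := ha.1
      rw [hA', ← h1]
      field_simp
      ring
    refine ⟨a, hapos, ?_, ?_, ?_, ?_, hA', hζ, hX⟩
    · rw [pairing_self, hdesc]
    -- Both sides are compared after multiplication by the decrease `D`: `A' D = a² G / 2 ≤ a² γ m
    -- D`.
    · have hD : 0 < dualObj C γ q θ - dualObj C γ q s'.η := by linarith
      refine le_of_mul_le_mul_right ?_ hD
      rw [← hdesc]
      nlinarith [mul_le_mul_of_nonneg_left hGm (sq_nonneg a)]
    · have := hmin (show (0 : ℝ) ∈ Set.Icc (0 : ℝ) 1 by simp)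
      simpa [hθ] using this
    · rw [hθ]
      exact lineSearch_ascent hmin hβ

/-! ### Convergence -/

/-- Convexity of `x log x`, with denominators cleared so that it fits the weighted inequality of the
estimate sequence. -/
theorem primalObj_average_le (C : Tensor m n ℝ) {γ : ℝ} (hγ : 0 ≤ γ) {X Y : Tensor m n ℝ}
    (hX : ∀ i, 0 ≤ X i) (hY : ∀ i, 0 ≤ Y i) {a b : ℝ} (ha : 0 < a) (hb : 0 ≤ b) :
    (b + a) * primalObj C γ (fun i => (a * X i + b * Y i) / (b + a))
      ≤ a * primalObj C γ X + b * primalObj C γ Y := by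
  have hab : 0 < b + a := by linarith
  have h : ∀ i, (b + a) * ((a * X i + b * Y i) / (b + a) *
      Real.log ((a * X i + b * Y i) / (b + a)))
      ≤ a * (X i * Real.log (X i)) + b * (Y i * Real.log (Y i)) := by
    intro i
    have h1 := Real.convexOn_mul_log.2 (show X i ∈ Set.Ici (0 : ℝ) from hX i)
      (show Y i ∈ Set.Ici (0 : ℝ) from hY i) (show 0 ≤ a / (b + a) by positivity)
      (show 0 ≤ b / (b + a) by positivity) (by field_simp; ring)
    simp only [smul_eq_mul] at h1
    have h2 : a / (b + a) * X i + b / (b + a) * Y i = (a * X i + b * Y i) / (b + a) := by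
      field_simp
    rw [h2] at h1
    calc _ ≤ (b + a) * (a / (b + a) * (X i * Real.log (X i))
          + b / (b + a) * (Y i * Real.log (Y i))) := mul_le_mul_of_nonneg_left h1 hab.le
      _ = _ := by field_simp
  have h2 := sum_le_sum fun i (_ : i ∈ (univ : Finset (Fin m → Fin n))) => h i
  rw [← mul_sum, sum_add_distrib, ← mul_sum, ← mul_sum] at h2
  have h3 : (b + a) * cost C (fun i => (a * X i + b * Y i) / (b + a))
      = a * cost C X + b * cost C Y := by
    simp only [cost, mul_sum, ← sum_add_distrib]
    exact sum_congr rfl fun i _ => by field_simp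
  unfold primalObj
  rw [mul_add, h3]
  nlinarith [mul_le_mul_of_nonneg_left h2 hγ]

/-- The primal average is nonnegative and, once it carries weight, a probability tensor. -/
structure Normalized (s : State m n ℝ) : Prop where
  A_nonneg : 0 ≤ s.A
  X_nonneg : ∀ i, 0 ≤ s.X i
  sum_X : s.A = 0 ∨ ∑ i, s.X i = 1

theorem Step.normalized [NeZero n] {C : Tensor m n ℝ} {γ : ℝ} (hγ : 0 < γ) {q : Vecs m n ℝ}
    (hq : ∀ k j, 0 < q k j) (hq1 : ∀ k, ∑ j, q k j = 1) {s s' : State m n ℝ}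
    (h : Step C γ q s s') (hs : Normalized s) : Normalized s' ∧ ∑ i, s'.X i = 1 := by
  obtain ⟨θ, ⟨a, ha⟩ | hf⟩ := h.accelerated_or_flat hγ hq hq1 hs.A_nonneg
  · have hA' : 0 < s'.A := by rw [ha.A_eq]; linarith [hs.A_nonneg, ha.weight_pos]
    have hsum : ∑ i, s'.X i = 1 := by
      rw [ha.X_eq]
      simp only [← sum_div, sum_add_distrib, ← mul_sum, sum_primalOf]
      rw [div_eq_one_iff_eq hA'.ne', ha.A_eq]
      rcases hs.sum_X with h0 | h0
      · rw [h0]; ring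
      · rw [h0]; ring
    refine ⟨⟨hA'.le, fun i => ?_, Or.inr hsum⟩, hsum⟩
    rw [ha.X_eq]
    have h1 := (primalOf_pos C γ θ i).le
    have h2 := hs.X_nonneg i
    have h3 := hs.A_nonneg
    have h4 := ha.weight_pos.le
    positivity
  · have hsum : ∑ i, s'.X i = 1 := by rw [hf.X_eq, sum_primalOf]
    exact ⟨⟨by rw [hf.A_eq]; exact hs.A_nonneg,
      fun i => by rw [hf.X_eq]; exact (primalOf_pos C γ θ i).le, Or.inr hsum⟩, hsum⟩

/-- The estimate-sequence inequality. -/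
def Estimate (C : Tensor m n ℝ) (γ : ℝ) (q : Vecs m n ℝ) (s : State m n ℝ) : Prop :=
  ∀ z : Vecs m n ℝ, s.A * (dualObj C γ q s.η + primalObj C γ s.X)
      + pairing (z - s.ζ) (z - s.ζ) / 2
    ≤ pairing z z / 2 + s.A * γ * pairing (marginal s.X - q) z

/-- Expanding `‖z - ζ'‖² / 2` produces `a² ‖∇φ(θ)‖² / 2`, which the descent identity cancels
exactly. The term `a ⟨∇φ(θ), θ⟩` from `primalObj_primalOf` combines with `-a ⟨∇φ(θ), ζ⟩` into a
nonpositive term by the line search, and `a ⟨∇φ(θ), z⟩` is precisely the increment of the right-hand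
side. -/
theorem AcceleratedStep.estimate [NeZero n] {C : Tensor m n ℝ} {γ : ℝ} (hγ : 0 < γ)
    {q : Vecs m n ℝ} {s s' : State m n ℝ} {θ : Vecs m n ℝ} {a : ℝ}
    (h : AcceleratedStep C γ q s s' θ a) (hs : Normalized s) (he : Estimate C γ q s) :
    Estimate C γ q s' := by
  intro z
  have hA := hs.A_nonneg
  have ha := h.weight_pos
  have hA' : 0 < s.A + a := by linarith
  have hF : s'.A * primalObj C γ s'.X
      ≤ a * primalObj C γ (primalOf C γ θ) + s.A * primalObj C γ s.X := by
    rw [h.X_eq, h.A_eq]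
    exact primalObj_average_le C hγ.le (fun i => (primalOf_pos C γ θ i).le) hs.X_nonneg ha hA
  have hm : s'.A * γ * pairing (marginal s'.X - q) z
      = a * pairing (dualGrad C γ q θ) z + s.A * γ * pairing (marginal s.X - q) z := by
    have : (s'.A * γ) • (marginal s'.X - q)
        = a • dualGrad C γ q θ + (s.A * γ) • (marginal s.X - q) := by
      funext k j
      rw [dualGrad_eq, h.X_eq, h.A_eq]
      simp only [Pi.smul_apply, Pi.sub_apply, Pi.add_apply, smul_eq_mul, marginal_div_const,
        marginal_add, marginal_const_mul]
      field_simp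
      ring
    rw [← pairing_smul_left, this, pairing_add_left, pairing_smul_left, pairing_smul_left]
  have hN : pairing (z - s'.ζ) (z - s'.ζ) = pairing (z - s.ζ) (z - s.ζ)
      + 2 * a * pairing (dualGrad C γ q θ) (z - s.ζ)
      + a ^ 2 * pairing (dualGrad C γ q θ) (dualGrad C γ q θ) := by
    have : z - s'.ζ = (z - s.ζ) + a • dualGrad C γ q θ := by rw [h.ζ_eq]; abel
    rw [this, pairing_add_left, pairing_add_right, pairing_add_right, pairing_smul_left,
      pairing_smul_left, pairing_smul_right, pairing_smul_right,
      pairing_comm (z - s.ζ) (dualGrad C γ q θ)]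
    ring
  have hd := h.descent
  have hdir := mul_nonneg ha.le h.ascent_dir
  have hprev := mul_le_mul_of_nonneg_left h.le_prev hA
  rw [hm, hN]
  rw [primalObj_primalOf C hγ q θ] at hF
  rw [pairing_sub_right] at hdir
  rw [pairing_sub_right (dualGrad C γ q θ)]
  have hA'e : s'.A * dualObj C γ q θ = s.A * dualObj C γ q θ + a * dualObj C γ q θ := by
    rw [h.A_eq]; ring
  have := he z
  nlinarith

theorem Estimate.gap_le {C : Tensor m n ℝ} {γ : ℝ} (hγ : 0 < γ) {q : Vecs m n ℝ}
    {s : State m n ℝ} (he : Estimate C γ q s) (hA : 0 < s.A) (c : ℝ) :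
    c * (∑ k, ∑ j, |marginal s.X k j - q k j|) + primalObj C γ s.X + dualObj C γ q s.η
      ≤ (c / γ) ^ 2 * (m * n) / (2 * s.A) := by
  -- The entries of `z` are `∓ c/γ` with signs opposite to the marginal defects: the pairing becomes
  -- `-c` times the ℓ¹ infeasibility, and `‖z‖² = (c/γ)² m n`.
  set z : Vecs m n ℝ := fun k j => if 0 ≤ marginal s.X k j - q k j then -(c / γ) else c / γ with hz
  have h := he z
  have h1 : pairing z z = (c / γ) ^ 2 * (m * n) := by
    have : ∀ k j, z k j * z k j = (c / γ) ^ 2 := by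
      intro k j
      simp only [hz]
      split_ifs <;> ring
    simp only [pairing, this, sum_const, card_univ, Fintype.card_fin, nsmul_eq_mul]
    ring
  have h2 : γ * pairing (marginal s.X - q) z
      = -(c * ∑ k, ∑ j, |marginal s.X k j - q k j|) := by
    simp only [pairing, mul_sum, ← sum_neg_distrib]
    refine sum_congr rfl fun k _ => sum_congr rfl fun j _ => ?_
    simp only [hz, Pi.sub_apply]
    split_ifs with h0
    · rw [abs_of_nonneg h0]
      field_simp
    · rw [abs_of_neg (not_le.1 h0)]
      field_simp
  have h3 : 0 ≤ pairing (z - s.ζ) (z - s.ζ) := by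
    rw [pairing_self]
    exact sum_blockSq_nonneg _
  rw [le_div_iff₀ (by positivity), ← h1]
  rw [mul_assoc, h2] at h
  nlinarith

/-- With `L = γ m` and `y = 2 L a`, one has `t² + 2y ≤ 4 L A'` and `4 L A' ≤ y²`. If the claim
failed, the first would give `y < t + 1/2`, while the two together give `(y - 1)² > t²` with `y ≥
2`, that is `y > t + 1`. -/
theorem AcceleratedStep.sqrt_growth {C : Tensor m n ℝ} {γ : ℝ}
    {q : Vecs m n ℝ} {s s' : State m n ℝ} {θ : Vecs m n ℝ} {a : ℝ}
    (h : AcceleratedStep C γ q s s' θ a) (hA : 0 ≤ s.A) {t : ℝ}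
    (hst : t ^ 2 ≤ 4 * (γ * m) * s.A) : (t + 1) ^ 2 ≤ 4 * (γ * m) * s'.A := by
  have ha := h.weight_pos
  have hg := h.growth
  have hA' : 0 < s'.A := by rw [h.A_eq]; linarith
  set L := γ * m with hL
  have hL0 : 0 < L := by
    by_contra hcon
    have : L * a ^ 2 ≤ 0 := mul_nonpos_of_nonpos_of_nonneg (not_lt.1 hcon) (sq_nonneg a)
    linarith
  have hAe := h.A_eq
  have h2 : L * s'.A ≤ (L * a) ^ 2 := by nlinarith
  obtain ⟨y, hy⟩ : ∃ y, y = 2 * (L * a) := ⟨_, rfl⟩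
  have hx : 0 < y := by rw [hy]; positivity
  have h4 : t ^ 2 + 2 * y ≤ 4 * L * s'.A := by rw [hAe, hy]; linarith
  by_contra! hcon
  have h5 : 2 * y < 2 * t + 1 := by linarith
  have h6 : t ^ 2 + 2 * y ≤ y ^ 2 := by rw [hy] at h4 ⊢; linarith
  have h7 : 2 ≤ y := by
    by_contra! hlt
    nlinarith [mul_pos hx (sub_pos.2 hlt)]
  nlinarith [mul_nonneg (show 0 ≤ t + 1 / 2 - y by linarith) (show 0 ≤ t + 1 / 2 + y - 2 by linarith)]

/-- The quantity of the stopping test, with weight `c` on the infeasibility. -/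
noncomputable def gap (C : Tensor m n ℝ) (γ : ℝ) (q : Vecs m n ℝ) (c : ℝ) (s : State m n ℝ) : ℝ :=
  c * (∑ k, ∑ j, |marginal s.X k j - q k j|) + primalObj C γ s.X + dualObj C γ q s.η

/-- At a zero gradient the marginals are exact and `F(X(θ)) = -φ(θ)`, so primal and dual values
cancel. -/
theorem FlatStep.gap_eq_zero [NeZero n] {C : Tensor m n ℝ} {γ : ℝ} (hγ : 0 < γ)
    {q : Vecs m n ℝ} {s s' : State m n ℝ} {θ : Vecs m n ℝ} (h : FlatStep C γ q s s' θ) (c : ℝ) :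
    gap C γ q c s' = 0 := by
  rw [gap, h.marginal_eq, h.X_eq, h.dual_eq, primalObj_primalOf C hγ q, h.grad_eq]
  simp [pairing]

theorem normalized_init : Normalized (State.init m n) :=
  ⟨le_rfl, fun _ => le_rfl, Or.inl rfl⟩

theorem estimate_init (C : Tensor m n ℝ) (γ : ℝ) (q : Vecs m n ℝ) :
    Estimate C γ q (State.init m n) := by
  intro z
  have : z - (State.init m n).ζ = z := by
    funext k j
    simp [State.init]
  rw [this]
  simp [State.init]

section Run

variable [NeZero n] {C : Tensor m n ℝ} {γ : ℝ} {q : Vecs m n ℝ} {s : ℕ → State m n ℝ}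

theorem normalized_of_steps (hγ : 0 < γ) (hq : ∀ k j, 0 < q k j) (hq1 : ∀ k, ∑ j, q k j = 1)
    (h0 : s 0 = State.init m n) (hs : ∀ t, Step C γ q (s t) (s (t + 1))) (t : ℕ) :
    Normalized (s t) := by
  induction t with
  | zero => rw [h0]; exact normalized_init
  | succ t ih => exact ((hs t).normalized hγ hq hq1 ih).1

theorem exists_gap_le (hγ : 0 < γ) (hq : ∀ k j, 0 < q k j) (hq1 : ∀ k, ∑ j, q k j = 1)
    (h0 : s 0 = State.init m n) (hs : ∀ t, Step C γ q (s t) (s (t + 1))) (c : ℝ) {N : ℕ}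
    (hN : 1 ≤ N) :
    ∃ t, 1 ≤ t ∧ t ≤ N ∧ gap C γ q c (s t) ≤ 2 * c ^ 2 * m ^ 2 * n / (γ * N ^ 2) := by
  have hnorm := normalized_of_steps hγ hq hq1 h0 hs
  -- A flat step replaces `X` without changing `A`, so the estimate is not carried across it; it is
  -- not needed there, because the gap is already zero.
  by_cases hflat : ∃ t < N, ∃ θ, FlatStep C γ q (s t) (s (t + 1)) θ
  · obtain ⟨t, ht, θ, hθ⟩ := hflat
    refine ⟨t + 1, by omega, by omega, ?_⟩
    rw [hθ.gap_eq_zero hγ]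
    positivity
  push Not at hflat
  have key : ∀ t ≤ N, Estimate C γ q (s t) ∧ (t : ℝ) ^ 2 ≤ 4 * (γ * m) * (s t).A := by
    intro t
    induction t with
    | zero =>
      intro _
      rw [h0]
      exact ⟨estimate_init C γ q, by simp [State.init]⟩
    | succ t ih =>
      intro ht
      obtain ⟨h1, h2⟩ := ih (by omega)
      obtain ⟨θ, ⟨a, ha⟩ | hf⟩ := (hs t).accelerated_or_flat hγ hq hq1 (hnorm t).A_nonneg
      · refine ⟨ha.estimate hγ (hnorm t) h1, ?_⟩
        push_cast
        exact ha.sqrt_growth (hnorm t).A_nonneg h2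
      · exact absurd hf (hflat t (by omega) θ)
  obtain ⟨h1, h2⟩ := key N le_rfl
  refine ⟨N, hN, le_rfl, ?_⟩
  have hNR : (0 : ℝ) < N := by exact_mod_cast hN
  have hA : 0 < (s N).A := by
    refine lt_of_le_of_ne (hnorm N).A_nonneg fun h => ?_
    rw [← h] at h2
    nlinarith
  refine (h1.gap_le hγ hA c).trans ?_
  rw [div_le_div_iff₀ (by positivity) (by positivity)]
  calc (c / γ) ^ 2 * (m * n) * (γ * N ^ 2) = c ^ 2 / γ * m * n * N ^ 2 := by field_simp
    _ ≤ c ^ 2 / γ * m * n * (4 * (γ * m) * (s N).A) :=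
        mul_le_mul_of_nonneg_left h2 (by positivity)
    _ = _ := by field_simp; ring

end Run

/-! ### Weak duality and entropy bounds -/

theorem sub_le_mul_log_sub {x y : ℝ} (hx : 0 ≤ x) (hy : 0 < y) :
    x - y ≤ x * Real.log x - x * Real.log y := by
  rcases hx.eq_or_lt with rfl | hx
  · simp [hy.le]
  have h := Real.log_le_sub_one_of_pos (div_pos hy hx)
  rw [Real.log_div hy.ne' hx.ne'] at h
  have h2 := mul_le_mul_of_nonneg_left h hx.le
  have h3 : x * (y / x - 1) = y - x := by field_simp
  nlinarith

/-- Weak duality from Gibbs' inequality: the relative entropy of `Z` from `X(η)` is nonnegative, and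
it equals `(F(Z) + φ(η)) / γ` because `Z` has marginals `q` and mass 1. -/
theorem neg_dualObj_le_primalObj [NeZero n] {C : Tensor m n ℝ} {γ : ℝ} (hγ : 0 < γ)
    {q : Vecs m n ℝ} (η : Vecs m n ℝ) {Z : Tensor m n ℝ} (hZ : Feasible q Z)
    (hZ1 : ∑ i, Z i = 1) : -dualObj C γ q η ≤ primalObj C γ Z := by
  have h := sum_le_sum fun i (_ : i ∈ univ) =>
    sub_le_mul_log_sub (hZ.1 i) (primalOf_pos C γ η i)
  rw [sum_sub_distrib, sum_sub_distrib, hZ1, sum_primalOf, sub_self] at h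
  have hl : ∀ i, Z i * Real.log (primalOf C γ η i) = Z i * ∑ k, η k (i k)
      - C i * Z i / γ - Z i * Real.log (kernelSum C γ η) := by
    intro i
    rw [log_primalOf]
    ring
  simp only [hl, sum_sub_distrib] at h
  rw [← pairing_marginal, ← sum_mul, hZ1, ← sum_div,
    show marginal Z = q from funext fun k => funext fun j => hZ.2 k j, pairing_comm] at h
  have h2 := mul_nonneg hγ.le h
  have h3 : γ * ((∑ i, C i * Z i) / γ) = ∑ i, C i * Z i := by field_simp
  rw [primalObj, dualObj_eq, cost]
  nlinarith

/-- Gibbs' inequality against the uniform tensor, whose entries are `n⁻ᵐ`. -/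
theorem neg_log_le_sum_mul_log [NeZero n] {X : Tensor m n ℝ} (hX : ∀ i, 0 ≤ X i)
    (hX1 : ∑ i, X i = 1) : -(m * Real.log n) ≤ ∑ i, X i * Real.log (X i) := by
  have hn : (0 : ℝ) < (n : ℝ) ^ m := pow_pos (by exact_mod_cast NeZero.pos n) _
  have h := sum_le_sum fun i (_ : i ∈ univ) =>
    sub_le_mul_log_sub (hX i) (inv_pos.2 hn)
  rw [sum_sub_distrib, sum_sub_distrib, hX1, ← sum_mul, hX1, Real.log_inv, Real.log_pow] at h
  simp only [sum_const, card_univ, Fintype.card_fun, Fintype.card_fin, nsmul_eq_mul,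
    Nat.cast_pow] at h
  rw [mul_inv_cancel₀ hn.ne'] at h
  linarith

theorem sum_mul_log_nonpos {X : Tensor m n ℝ} (hX : ∀ i, 0 ≤ X i) (hX1 : ∑ i, X i = 1) :
    ∑ i, X i * Real.log (X i) ≤ 0 := by
  refine sum_nonpos fun i _ => mul_nonpos_of_nonneg_of_nonpos (hX i) ?_
  refine Real.log_nonpos (hX i) ?_
  rw [← hX1]
  exact single_le_sum (fun i _ => hX i) (mem_univ i)

/-! ### Rounding -/

section Rounding

variable {p : Vecs m n ℝ}

theorem scaleDir_nonneg (hp : ∀ k j, 0 ≤ p k j) {V : Tensor m n ℝ} (hV : ∀ i, 0 ≤ V i)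
    (r : Fin m) (i : Fin m → Fin n) : 0 ≤ scaleDir p V r i :=
  mul_nonneg (hV i) (le_min (div_nonneg (hp _ _) (marginal_nonneg hV _ _)) zero_le_one)

theorem scaleDir_le {V : Tensor m n ℝ} (hV : ∀ i, 0 ≤ V i) (r : Fin m)
    (i : Fin m → Fin n) : scaleDir p V r i ≤ V i :=
  mul_le_of_le_one_right (hV i) (min_le_right _ _)

theorem marginal_scaleDir (V : Tensor m n ℝ) (r : Fin m) (j : Fin n) :
    marginal (scaleDir p V r) r j = marginal V r j * min (p r j / marginal V r j) 1 := by
  calc marginal (scaleDir p V r) r j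
      = ∑ i ∈ univ.filter (fun i : Fin m → Fin n => i r = j),
          V i * min (p r j / marginal V r j) 1 := by
        refine sum_congr rfl fun i hi => ?_
        rw [scaleDir, (mem_filter.1 hi).2]
    _ = _ := (sum_mul _ _ _).symm

theorem marginal_scaleDir_eq_min (hp : ∀ k j, 0 ≤ p k j) {V : Tensor m n ℝ} (hV : ∀ i, 0 ≤ V i)
    (r : Fin m) (j : Fin n) :
    marginal (scaleDir p V r) r j = min (p r j) (marginal V r j) := by
  rw [marginal_scaleDir]
  rcases (marginal_nonneg hV r j).eq_or_lt with h | h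
  · rw [← h, zero_mul, min_eq_right (hp r j)]
  · rw [mul_min_of_nonneg _ _ h.le, mul_div_cancel₀ _ h.ne', mul_one]

/-- The loss is measured against a fixed `X` above every intermediate `V`: scaling direction `r`
removes the positive part of `p_r(V) - p_r`, at most `|p_r(X) - p_r|` since `V ≤ X`. Later scalings
only decrease entries, so marginal bounds already achieved persist. -/
theorem foldl_scaleDir (hp : ∀ k j, 0 ≤ p k j) {X : Tensor m n ℝ} (l : List (Fin m)) :
    ∀ V : Tensor m n ℝ, (∀ i, 0 ≤ V i) → (∀ i, V i ≤ X i) →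
      (∀ i, 0 ≤ l.foldl (scaleDir p) V i) ∧ (∀ i, l.foldl (scaleDir p) V i ≤ V i) ∧
      (∀ r ∈ l, ∀ j, marginal (l.foldl (scaleDir p) V) r j ≤ p r j) ∧
      ∑ i, V i - ∑ i, l.foldl (scaleDir p) V i
        ≤ (l.map fun r => ∑ j, |marginal X r j - p r j|).sum := by
  induction l with
  | nil => intro V hV _; simp [hV]
  | cons r l ih =>
    intro V hV hVX
    have h1 := scaleDir_nonneg hp hV r
    have h2 := scaleDir_le (p := p) hV r
    obtain ⟨i1, i2, i3, i4⟩ := ih (scaleDir p V r) h1 fun i => (h2 i).trans (hVX i)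
    simp only [List.foldl_cons, List.map_cons, List.sum_cons]
    refine ⟨i1, fun i => (i2 i).trans (h2 i), ?_, ?_⟩
    · intro r' hr' j
      rcases List.mem_cons.1 hr' with rfl | hr'
      · refine (marginal_mono i2 _ j).trans ?_
        rw [marginal_scaleDir_eq_min hp hV]
        exact min_le_left _ _
      · exact i3 r' hr' j
    · have h3 : ∑ i, V i - ∑ i, scaleDir p V r i ≤ ∑ j, |marginal X r j - p r j| := by
        rw [← sum_marginal V r, ← sum_marginal (scaleDir p V r) r, ← sum_sub_distrib]
        refine sum_le_sum fun j _ => ?_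
        rw [marginal_scaleDir_eq_min hp hV]
        have h4 := marginal_mono hVX r j
        rcases le_total (p r j) (marginal V r j) with h | h
        · rw [min_eq_left h]
          exact (by linarith : _ ≤ marginal X r j - p r j).trans (le_abs_self _)
        · rw [min_eq_right h, sub_self]
          exact abs_nonneg _
      linarith

theorem marginal_prod {e : Vecs m n ℝ} {c : ℝ} (he : ∀ k, ∑ j, e k j = c) (k : Fin m)
    (j : Fin n) : marginal (fun i => ∏ k, e k (i k)) k j = e k j * c ^ (m - 1) := by
  have hf : (univ.filter fun i : Fin m → Fin n => i k = j)
      = Fintype.piFinset fun k' => if k' = k then {j} else univ := by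
    ext i
    simp only [mem_filter, mem_univ, true_and, Fintype.mem_piFinset]
    constructor
    · intro h k'
      split_ifs with hk
      · simp [hk, h]
      · simp
    · intro h
      simpa using h k
  rw [marginal, hf, ← prod_univ_sum, ← mul_prod_erase _ _ (mem_univ k)]
  have : ∏ x ∈ univ.erase k, ∑ j ∈ (if x = k then {j} else univ), e x j = c ^ (m - 1) := by
    rw [prod_congr rfl fun x hx => by rw [if_neg (mem_erase.1 hx).1, he x], prod_const,
      card_erase_of_mem (mem_univ k), card_univ, Fintype.card_fin]
  rw [this]
  simp

theorem rounding_spec [NeZero m] {C : Tensor m n ℝ} (hC : ∀ i, 0 ≤ C i)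
    (hp : ∀ k, p k ∈ stdSimplex ℝ (Fin n)) {X : Tensor m n ℝ} (hX : ∀ i, 0 ≤ X i)
    (hX1 : ∑ i, X i = 1) :
    Feasible p (rounding p X) ∧
      cost C (rounding p X) ≤ cost C X + ‖C‖ * ∑ k, ∑ j, |marginal X k j - p k j| := by
  obtain ⟨h1, h2, h3, h4⟩ := foldl_scaleDir (fun k j => (hp k).1 j) (List.finRange m) X hX
    fun i => le_rfl
  rw [← Fin.sum_univ_def] at h4
  change ∀ i, 0 ≤ scaled p X i at h1
  change ∀ i, scaled p X i ≤ X i at h2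
  change ∀ r ∈ _, ∀ j, marginal (scaled p X) r j ≤ p r j at h3
  change _ - ∑ i, scaled p X i ≤ _ at h4
  set W := scaled p X with hW
  set err : Vecs m n ℝ := fun k j => p k j - marginal W k j with herr
  have herr0 : ∀ k j, 0 ≤ err k j := fun k j => sub_nonneg.2 (h3 k (List.mem_finRange k) j)
  set c := 1 - ∑ i, W i with hc
  have hsum : ∀ k, ∑ j, err k j = c := by
    intro k
    simp only [herr, sum_sub_distrib, sum_marginal, (hp k).2, hc]
  have habs : ∑ j, |err (lastDir m) j| = c := by
    rw [← hsum (lastDir m)]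
    exact sum_congr rfl fun j _ => abs_of_nonneg (herr0 _ _)
  have hc0 : 0 ≤ c := by
    rw [← habs]
    exact sum_nonneg fun j _ => abs_nonneg _
  set N : Tensor m n ℝ := fun i => (∏ k, err k (i k)) / c ^ (m - 1) with hN
  have hR : rounding p X = fun i => W i + N i := by
    funext i
    simp only [rounding, ← hW, hN]
    rw [habs]
  have hN0 : ∀ i, 0 ≤ N i := fun i =>
    div_nonneg (prod_nonneg fun k _ => herr0 _ _) (pow_nonneg hc0 _)
  have hNm : ∀ k j, marginal N k j = err k j := by
    intro k j
    rw [hN, marginal_div_const, marginal_prod hsum]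
    -- If no mass is missing, all defects vanish and the convention `0/0 = 0` gives the right
    -- marginal.
    rcases eq_or_ne c 0 with h0 | h0
    · have : err k j = 0 := by
        have hk := hsum k
        rw [h0, sum_eq_zero_iff_of_nonneg fun j _ => herr0 k j] at hk
        exact hk j (mem_univ j)
      rw [this]
      simp
    · exact mul_div_cancel_right₀ _ (pow_ne_zero _ h0)
  refine ⟨⟨fun i => ?_, fun k j => ?_⟩, ?_⟩
  · rw [hR]
    exact add_nonneg (h1 i) (hN0 i)
  · rw [hR, marginal_add, hNm]
    simp [herr]
  · have hNs : ∑ i, N i = c := by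
      rw [← sum_marginal N (lastDir m)]
      simp only [hNm, hsum]
    have e1 : cost C (rounding p X) = ∑ i, C i * W i + ∑ i, C i * N i := by
      simp only [cost, hR, mul_add, sum_add_distrib]
    have e2 : ∑ i, C i * W i ≤ cost C X :=
      sum_le_sum fun i _ => mul_le_mul_of_nonneg_left (h2 i) (hC i)
    have e3 : ∑ i, C i * N i ≤ ‖C‖ * c := by
      rw [← hNs, mul_sum]
      exact sum_le_sum fun i _ => mul_le_mul_of_nonneg_right
        ((le_abs_self _).trans (norm_le_pi_norm C i)) (hN0 i)
    have e4 : ‖C‖ * c ≤ ‖C‖ * ∑ k, ∑ j, |marginal X k j - p k j| := by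
      refine mul_le_mul_of_nonneg_left ?_ (norm_nonneg _)
      rw [hc, ← hX1]
      exact h4
    linarith

end Rounding

/-! ### The stopping test certifies an approximate solution -/

/-- The weight of the uniform distribution in the perturbed marginals. -/
noncomputable def mixing (C : Tensor m n ℝ) (ε : ℝ) : ℝ := epsOf C ε / (4 * m)

section Main

variable {C : Tensor m n ℝ} {p : Vecs m n ℝ} {ε : ℝ}

theorem norm_pos_of_le (hε : 0 < ε) (hε' : ε ≤ 32 * m * ‖C‖) : 0 < ‖C‖ := by
  refine lt_of_le_of_ne (norm_nonneg _) fun h => ?_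
  rw [← h] at hε'
  linarith

theorem perturbed_apply (k : Fin m) (j : Fin n) :
    perturbed C p ε k j = (1 - mixing C ε) * p k j + mixing C ε / n := by
  rw [perturbed, mixing]
  ring

theorem mixing_pos [NeZero m] (hε : 0 < ε) (hε' : ε ≤ 32 * m * ‖C‖) : 0 < mixing C ε := by
  have hC := norm_pos_of_le hε hε'
  have hm : (0 : ℝ) < m := by exact_mod_cast NeZero.pos m
  unfold mixing epsOf
  positivity

theorem mixing_le_one [NeZero m] (hε : 0 < ε) (hε' : ε ≤ 32 * m * ‖C‖) : mixing C ε ≤ 1 := by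
  have hC := norm_pos_of_le hε hε'
  have hm : (0 : ℝ) < m := by exact_mod_cast NeZero.pos m
  rw [mixing, epsOf, div_div, div_le_one (by positivity)]
  linarith

theorem norm_mul_mixing [NeZero m] (hε : 0 < ε) (hε' : ε ≤ 32 * m * ‖C‖) :
    ‖C‖ * mixing C ε = ε / (32 * m) := by
  have hC := norm_pos_of_le hε hε'
  have hm : (m : ℝ) ≠ 0 := by exact_mod_cast NeZero.ne m
  rw [mixing, epsOf]
  field_simp
  norm_num

theorem perturbed_pos [NeZero m] [NeZero n] (hp : ∀ k, p k ∈ stdSimplex ℝ (Fin n)) (hε : 0 < ε)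
    (hε' : ε ≤ 32 * m * ‖C‖) (k : Fin m) (j : Fin n) : 0 < perturbed C p ε k j := by
  rw [perturbed_apply]
  have h1 := mixing_pos hε hε'
  have h2 := mixing_le_one hε hε'
  have h3 := (hp k).1 j
  have hn : (0 : ℝ) < n := by exact_mod_cast NeZero.pos n
  exact add_pos_of_nonneg_of_pos (mul_nonneg (by linarith) h3) (div_pos h1 hn)

theorem sum_perturbed [NeZero n] (hp : ∀ k, p k ∈ stdSimplex ℝ (Fin n)) (k : Fin m) :
    ∑ j, perturbed C p ε k j = 1 := by
  have hn : (n : ℝ) ≠ 0 := by exact_mod_cast NeZero.ne n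
  simp only [perturbed_apply, sum_add_distrib, ← mul_sum, (hp k).2, sum_const, card_univ,
    Fintype.card_fin, nsmul_eq_mul]
  field_simp
  ring

theorem sum_abs_perturbed_sub_le [NeZero m] [NeZero n] (hp : ∀ k, p k ∈ stdSimplex ℝ (Fin n))
    (hε : 0 < ε) (hε' : ε ≤ 32 * m * ‖C‖) (k : Fin m) :
    ∑ j, |perturbed C p ε k j - p k j| ≤ 2 * mixing C ε := by
  have hn : (0 : ℝ) < n := by exact_mod_cast NeZero.pos n
  have h1 := (mixing_pos hε hε').le
  calc ∑ j, |perturbed C p ε k j - p k j| ≤ ∑ j, (mixing C ε / n + mixing C ε * p k j) := by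
        refine sum_le_sum fun j _ => ?_
        have h3 := mul_nonneg h1 ((hp k).1 j)
        have h4 := div_nonneg h1 hn.le
        rw [perturbed_apply, abs_le]
        constructor <;> linarith
    _ = 2 * mixing C ε := by
        simp only [sum_add_distrib, ← mul_sum, (hp k).2, sum_const, card_univ,
          Fintype.card_fin, nsmul_eq_mul]
        field_simp
        ring

/-- Mixing a feasible tensor with the uniform one gives a tensor with the perturbed marginals. -/
theorem exists_feasible_perturbed [NeZero m] [NeZero n] (hC : ∀ i, 0 ≤ C i)
    (hp : ∀ k, p k ∈ stdSimplex ℝ (Fin n)) (hε : 0 < ε) (hε' : ε ≤ 32 * m * ‖C‖)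
    {Y : Tensor m n ℝ} (hY : Feasible p Y) :
    ∃ Z, Feasible (perturbed C p ε) Z ∧ ∑ i, Z i = 1 ∧
      cost C Z ≤ cost C Y + ‖C‖ * mixing C ε := by
  have hn : (0 : ℝ) < n := by exact_mod_cast NeZero.pos n
  have h0 := mixing_pos hε hε'
  have h1 := mixing_le_one hε hε'
  have hs := sum_perturbed (C := C) (ε := ε) hp
  set δ := mixing C ε with hδ
  -- The uniform tensor in product form, so that `marginal_prod` applies with `c = 1`.
  set N : Tensor m n ℝ := fun _ => ∏ _k : Fin m, (1 / n : ℝ) with hN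
  have hNm : ∀ k j, marginal N k j = 1 / n := by
    intro k j
    rw [hN, marginal_prod (e := fun _ _ => (1 / n : ℝ)) (c := 1)]
    · simp
    · intro k
      simp [hn.ne']
  have hN1 : ∑ i, N i = 1 := by
    rw [← sum_marginal N 0]
    simp [hNm, hn.ne']
  have hN0 : ∀ i, 0 ≤ N i := fun i => prod_nonneg fun k _ => by positivity
  have hZ : Feasible (perturbed C p ε) fun i => (1 - δ) * Y i + δ * N i := by
    refine ⟨fun i => ?_, fun k j => ?_⟩
    · exact add_nonneg (mul_nonneg (by linarith) (hY.1 i)) (mul_nonneg h0.le (hN0 i))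
    · rw [marginal_add, marginal_const_mul, marginal_const_mul, hY.2, hNm, perturbed_apply]
      ring
  refine ⟨_, hZ, ?_, ?_⟩
  · rw [← sum_marginal _ 0, sum_congr rfl fun j _ => hZ.2 0 j, hs]
  · have e1 : cost C (fun i => (1 - δ) * Y i + δ * N i)
        = (1 - δ) * cost C Y + δ * ∑ i, C i * N i := by
      simp only [cost, mul_sum, ← sum_add_distrib]
      exact sum_congr rfl fun i _ => by ring
    have e2 : ∑ i, C i * N i ≤ ‖C‖ := by
      calc ∑ i, C i * N i ≤ ∑ i, ‖C‖ * N i := sum_le_sum fun i _ =>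
            mul_le_mul_of_nonneg_right ((le_abs_self _).trans (norm_le_pi_norm C i)) (hN0 i)
        _ = ‖C‖ := by rw [← mul_sum, hN1, mul_one]
    have e3 : 0 ≤ cost C Y := sum_nonneg fun i _ => mul_nonneg (hC i) (hY.1 i)
    rw [e1]
    nlinarith

theorem gammaOf_pos [NeZero m] (hn : 2 ≤ n) (hε : 0 < ε) : 0 < gammaOf m n ε := by
  have hm : (0 : ℝ) < m := by exact_mod_cast NeZero.pos m
  have hl : 0 < Real.log n := Real.log_pos (by exact_mod_cast hn)
  unfold gammaOf
  positivity

theorem Stop.isApproxSolution [NeZero m] (hm : 2 ≤ m) (hn : 2 ≤ n) (hC : ∀ i, 0 ≤ C i)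
    (hp : ∀ k, p k ∈ stdSimplex ℝ (Fin n)) (hε : 0 < ε) (hε' : ε ≤ 32 * m * ‖C‖)
    {s : State m n ℝ} (hs : Stop C p ε s) (hX : ∀ i, 0 ≤ s.X i) (hX1 : ∑ i, s.X i = 1) :
    IsApproxSolution C p ε (rounding p s.X) := by
  have : NeZero n := ⟨by omega⟩
  have hγ := gammaOf_pos (m := m) hn hε
  have hmR : (2 : ℝ) ≤ m := by exact_mod_cast hm
  obtain ⟨hfeas, hcost⟩ := rounding_spec hC hp hX hX1
  refine ⟨hfeas, fun Y hY => ?_⟩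
  obtain ⟨Z, hZ, hZ1, hZc⟩ := exists_feasible_perturbed hC hp hε hε' hY
  have hdual := neg_dualObj_le_primalObj (C := C) hγ s.η hZ hZ1
  have hent : gammaOf m n ε * ∑ i, Z i * Real.log (Z i) ≤ 0 :=
    mul_nonpos_of_nonneg_of_nonpos hγ.le (sum_mul_log_nonpos hZ.1 hZ1)
  have hentX := mul_le_mul_of_nonneg_left (neg_log_le_sum_mul_log hX hX1) hγ.le
  have hl : 0 < Real.log n := Real.log_pos (by exact_mod_cast hn)
  have hγe : gammaOf m n ε * -(m * Real.log n) = -(ε / 2) := by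
    unfold gammaOf
    field_simp
  have hδ := norm_mul_mixing (C := C) hε hε'
  have htri : ∑ k, ∑ j, |marginal s.X k j - p k j|
      ≤ ∑ k, ∑ j, |marginal s.X k j - perturbed C p ε k j| + m * (2 * mixing C ε) := by
    calc _ ≤ ∑ k, (∑ j, |marginal s.X k j - perturbed C p ε k j| + 2 * mixing C ε) := by
          refine sum_le_sum fun k _ => ?_
          refine le_trans ?_ (add_le_add le_rfl (sum_abs_perturbed_sub_le hp hε hε' k))
          rw [← sum_add_distrib]
          exact sum_le_sum fun j _ => abs_sub_le _ _ _
      _ = _ := by simp [sum_add_distrib]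
  have h1 := mul_le_mul_of_nonneg_left htri (norm_nonneg C)
  have h2 : ‖C‖ * (m * (2 * mixing C ε)) = ε / 16 := by
    have : ‖C‖ * (m * (2 * mixing C ε)) = 2 * m * (‖C‖ * mixing C ε) := by ring
    rw [this, hδ]
    field_simp
    norm_num
  have h3 : ε / (32 * m) ≤ ε / 64 := div_le_div_of_nonneg_left hε.le (by norm_num) (by linarith)
  have h4 : 0 ≤ ‖C‖ * ∑ k, ∑ j, |marginal s.X k j - perturbed C p ε k j| :=
    mul_nonneg (norm_nonneg _) (sum_nonneg fun k _ => sum_nonneg fun j _ => abs_nonneg _)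
  unfold Stop at hs
  unfold primalObj at hs hdual
  rw [mul_add] at h1
  rw [hδ] at hZc
  rw [hγe] at hentX
  -- The error budget is `ε/2` for the entropy of `X`, `3ε/8` for the test, `ε/16` for rounding to
  -- `p` instead of `q`, and `ε/64` for perturbing `Y`: in total `61ε/64`. One of the two copies of
  -- `‖C‖` times the infeasibility pays for rounding; the other is dropped.
  nlinarith

end Main

/-! ### Values and costs of programs -/

namespace Counted

variable {α β : Type}

theorem val_pure (a : α) : (pure a : Counted α).val = a := rfl

theorem ops_pure (a : α) : (pure a : Counted α).ops = 0 := rfl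

theorem val_bind (x : Counted α) (f : α → Counted β) : (x >>= f).val = (f x.val).val := rfl

theorem ops_bind (x : Counted α) (f : α → Counted β) :
    (x >>= f).ops = x.ops + (f x.val).ops := rfl

theorem val_tabulate {ι : Type} [Fintype ι] (f : ι → Counted α) :
    (tabulate f).val = fun i => (f i).val := rfl

theorem ops_tabulate {ι : Type} [Fintype ι] (f : ι → Counted α) :
    (tabulate f).ops = ∑ i, (f i).ops := rfl

theorem val_ite (c : Prop) [Decidable c] (x y : Counted α) :
    (if c then x else y).val = if c then x.val else y.val := apply_ite _ _ _ _

/-- The bound on the continuation is uniform in its argument, so costs can be estimated without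
knowing intermediate values. -/
theorem ops_bind_le {x : Counted α} {f : α → Counted β} {a b : ℕ} (hx : x.ops ≤ a)
    (hf : ∀ y, (f y).ops ≤ b) : (x >>= f).ops ≤ a + b := add_le_add hx (hf _)

theorem ops_tabulate_le {ι : Type} [Fintype ι] {f : ι → Counted α} {c : ℕ}
    (h : ∀ i, (f i).ops ≤ c) : (tabulate f).ops ≤ Fintype.card ι * c := by
  rw [ops_tabulate]
  refine (sum_le_sum fun i _ => h i).trans ?_
  simp

/-- A sum instead of a maximum keeps all bounds polynomial, so that they can be compared by linear
arithmetic. -/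
theorem ops_ite_le {c : Prop} [Decidable c] {x y : Counted α} {a b : ℕ} (hx : x.ops ≤ a)
    (hy : y.ops ≤ b) : (if c then x else y).ops ≤ a + b := by
  split_ifs
  · exact hx.trans (Nat.le_add_right _ _)
  · exact hy.trans (Nat.le_add_left _ _)

theorem val_foldlM {ι : Type} (f : β → ι → Counted β) (l : List ι) :
    ∀ z, (l.foldlM f z).val = l.foldl (fun b i => (f b i).val) z := by
  induction l with
  | nil => intro z; rfl
  | cons i l ih => intro z; exact ih _

theorem ops_foldlM {ι : Type} {f : β → ι → Counted β} {c : ℕ} (h : ∀ b i, (f b i).ops = c)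
    (l : List ι) : ∀ z, (l.foldlM f z).ops = l.length * c := by
  induction l with
  | nil => intro z; simp [List.foldlM_nil, ops_pure]
  | cons i l ih =>
    intro z
    rw [List.foldlM_cons, ops_bind, ih, h, List.length_cons]
    ring

theorem ops_foldlM_le {ι : Type} {f : β → ι → Counted β} {c : ℕ} (h : ∀ b i, (f b i).ops ≤ c)
    (l : List ι) : ∀ z, (l.foldlM f z).ops ≤ l.length * c := by
  induction l with
  | nil => intro z; simp [List.foldlM_nil, ops_pure]
  | cons i l ih =>
    intro z
    rw [List.foldlM_cons, ops_bind, List.length_cons]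
    linarith [ih (f z i).val, h z i]

end Counted

/-! ### Correctness and operation counts of the subroutines on the real machine -/

namespace Machine

open Counted

variable (ls : Tensor m n ℝ → Tensor m n ℝ → ℝ → ℝ)

theorem const_ops (k : ℕ) : ((realMachine ls).const k).ops = 1 := rfl

theorem add_ops (x y : ℝ) : ((realMachine ls).add x y).ops = 1 := rfl

theorem sub_ops (x y : ℝ) : ((realMachine ls).sub x y).ops = 1 := rfl

theorem mul_ops (x y : ℝ) : ((realMachine ls).mul x y).ops = 1 := rfl

theorem div_ops (x y : ℝ) : ((realMachine ls).div x y).ops = 1 := rfl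

theorem min_ops (x y : ℝ) : ((realMachine ls).min x y).ops = 1 := rfl

theorem abs_ops (x : ℝ) : ((realMachine ls).abs x).ops = 1 := rfl

theorem exp_ops (x : ℝ) : ((realMachine ls).exp x).ops = 1 := rfl

theorem log_ops (x : ℝ) : ((realMachine ls).log x).ops = 1 := rfl

theorem sqrt_ops (x : ℝ) : ((realMachine ls).sqrt x).ops = 1 := rfl

theorem le_ops (x y : ℝ) : ((realMachine ls).le x y).ops = 1 := rfl

theorem lineMin_ops (a b : Tensor m n ℝ) (c : ℝ) :
    ((realMachine ls).lineMin a b c).ops = 2 * n ^ m + 1 := rfl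

theorem sum_val {ι : Type} (s : Finset ι) (f : ι → Counted ℝ) :
    ((realMachine ls).sum s f).val = ∑ i ∈ s, (f i).val := by
  have h : ∀ (l : List ι) (z : ℝ),
      l.foldl (fun b i => b + (f i).val) z = z + (l.map fun i => (f i).val).sum := by
    intro l
    induction l with
    | nil => simp
    | cons i l ih => intro z; simp [ih, add_assoc]
  unfold Machine.sum
  rw [val_bind, val_foldlM]
  refine (h _ _).trans ?_
  rw [Finset.sum_map_toList]
  simp [realMachine]

theorem sum_pure_ops {ι : Type} (s : Finset ι) (f : ι → ℝ) :
    ((realMachine ls).sum s fun i => pure (f i)).ops = 1 + #s := by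
  unfold Machine.sum
  rw [ops_bind, ops_foldlM (c := 1) fun b i => rfl, length_toList, mul_one]
  rfl

theorem sum_ops_le {ι : Type} {s : Finset ι} {f : ι → Counted ℝ} {c : ℕ}
    (h : ∀ i, (f i).ops ≤ c) : ((realMachine ls).sum s f).ops ≤ 1 + #s * (c + 1) := by
  unfold Machine.sum
  rw [← length_toList]
  exact ops_bind_le le_rfl fun z =>
    ops_foldlM_le (fun b i => ops_bind_le (h i) fun y => (add_ops ls _ _).le) _ _

theorem prod_val {ι : Type} (s : Finset ι) (f : ι → Counted ℝ) :
    ((realMachine ls).prod s f).val = ∏ i ∈ s, (f i).val := by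
  have h : ∀ (l : List ι) (z : ℝ),
      l.foldl (fun b i => b * (f i).val) z = z * (l.map fun i => (f i).val).prod := by
    intro l
    induction l with
    | nil => simp
    | cons i l ih => intro z; simp [ih, mul_assoc]
  unfold Machine.prod
  rw [val_bind, val_foldlM]
  refine (h _ _).trans ?_
  rw [Finset.prod_map_toList]
  simp [realMachine]

theorem prod_ops_le {ι : Type} {s : Finset ι} {f : ι → Counted ℝ} {c : ℕ}
    (h : ∀ i, (f i).ops ≤ c) : ((realMachine ls).prod s f).ops ≤ 1 + #s * (c + 1) := by
  unfold Machine.prod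
  rw [← length_toList]
  exact ops_bind_le le_rfl fun z =>
    ops_foldlM_le (fun b i => ops_bind_le (h i) fun y => (mul_ops ls _ _).le) _ _

theorem marginalDir_val (X : Tensor m n ℝ) (k : Fin m) :
    ((realMachine ls).marginalDir X k).val = marginal X k := by
  funext j
  exact sum_val ls _ _

/-- The slices in one direction partition the `n ^ m` entries, so each entry is added once; the
extra `n` counts the initial zeros of the sums. -/
theorem marginalDir_ops (X : Tensor m n ℝ) (k : Fin m) :
    ((realMachine ls).marginalDir X k).ops = n + n ^ m := by
  rw [marginalDir, ops_tabulate]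
  simp only [sum_pure_ops, sum_add_distrib]
  rw [← card_eq_sum_card_fiberwise fun _ _ => mem_univ _]
  simp

theorem marginals_val (X : Tensor m n ℝ) :
    ((realMachine ls).marginals X).val = marginal X := by
  funext k
  exact marginalDir_val ls X k

theorem marginals_ops (X : Tensor m n ℝ) :
    ((realMachine ls).marginals X).ops = m * (n + n ^ m) := by
  rw [marginals, ops_tabulate]
  simp [marginalDir_ops]

theorem tensorSum_val (u : Vecs m n ℝ) :
    ((realMachine ls).tensorSum u).val = fun i => ∑ k, u k (i k) := by
  funext i
  exact sum_val ls _ _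

theorem tensorSum_ops (u : Vecs m n ℝ) :
    ((realMachine ls).tensorSum u).ops = n ^ m * (1 + m) := by
  rw [tensorSum, ops_tabulate]
  simp [sum_pure_ops]

theorem dot_val (u v : Vecs m n ℝ) : ((realMachine ls).dot u v).val = pairing u v := by
  simp only [dot, sum_val]
  rfl

theorem dot_ops_le (u v : Vecs m n ℝ) :
    ((realMachine ls).dot u v).ops ≤ 1 + m * (2 + 2 * n) := by
  unfold dot
  -- The intermediate bound is a metavariable, filled in as the rules follow the structure of the
  -- program; only a polynomial inequality then remains. The later cost bounds work in the same way.
  apply le_trans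
  · repeat' with_reducible first
        | intro _
        | apply sum_ops_le
        | exact Nat.le_of_eq (mul_ops ls _ _)
  · simp only [card_univ, Fintype.card_fin]
    linarith

theorem total_val (X : Tensor m n ℝ) : ((realMachine ls).total X).val = ∑ i, X i := by
  rw [total, sum_val]
  rfl

theorem total_ops (X : Tensor m n ℝ) : ((realMachine ls).total X).ops = 1 + n ^ m := by
  rw [total, sum_pure_ops]
  simp

theorem supNorm_val (X : Tensor m n ℝ) : ((realMachine ls).supNorm X).val = ‖X‖ := by
  -- The fold is characterized as a least upper bound of the start value and the visited entries,
  -- which matches the sup norm without computing with lists.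
  have h : ∀ (l : List (Fin m → Fin n)) (z : ℝ),
      z ≤ l.foldl (fun b i => b ⊔ |X i|) z ∧
      (∀ i ∈ l, |X i| ≤ l.foldl (fun b i => b ⊔ |X i|) z) ∧
      ∀ b, z ≤ b → (∀ i, |X i| ≤ b) → l.foldl (fun b i => b ⊔ |X i|) z ≤ b := by
    intro l
    induction l with
    | nil => exact fun z => ⟨le_rfl, by simp, fun b hz _ => hz⟩
    | cons i l ih =>
      intro z
      obtain ⟨h1, h2, h3⟩ := ih (z ⊔ |X i|)
      refine ⟨le_sup_left.trans h1, fun i' hi' => ?_, fun b hz hb => h3 b (sup_le hz (hb i)) hb⟩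
      rcases List.mem_cons.1 hi' with rfl | hi'
      · exact le_sup_right.trans h1
      · exact h2 i' hi'
  unfold supNorm
  rw [val_bind, val_foldlM]
  have hz : ((realMachine ls).const 0).val = 0 := by simp [realMachine]
  rw [hz]
  obtain ⟨h1, h2, h3⟩ := h univ.toList 0
  refine le_antisymm (h3 _ (norm_nonneg _) fun i => norm_le_pi_norm X i) ?_
  exact (pi_norm_le_iff_of_nonneg h1).2 fun i => h2 i (by simp)

theorem supNorm_ops (X : Tensor m n ℝ) :
    ((realMachine ls).supNorm X).ops = 1 + 2 * n ^ m := by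
  unfold supNorm
  rw [ops_bind, ops_foldlM (c := 2) fun b i => rfl, const_ops]
  simp [mul_comm]

theorem argmax_spec [NeZero m] (f : Fin m → ℝ) (k : Fin m) :
    f k ≤ f ((realMachine ls).argmax f).val := by
  have h : ∀ (l : List (Fin m)) (b : Fin m),
      f b ≤ f (l.foldl (fun b k => if f k ≤ f b then b else k) b) ∧
      ∀ k ∈ l, f k ≤ f (l.foldl (fun b k => if f k ≤ f b then b else k) b) := by
    intro l
    induction l with
    | nil => intro b; simp
    | cons k l ih =>
      intro b
      obtain ⟨h1, h2⟩ := ih (if f k ≤ f b then b else k)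
      have h3 : f b ≤ f (if f k ≤ f b then b else k) ∧ f k ≤ f (if f k ≤ f b then b else k) := by
        split_ifs with h
        · exact ⟨le_rfl, h⟩
        · exact ⟨(not_le.1 h).le, le_rfl⟩
      refine ⟨h3.1.trans h1, fun k' hk' => ?_⟩
      rcases List.mem_cons.1 hk' with rfl | hk'
      · exact h3.2.trans h1
      · exact h2 k' hk'
  have hf : ((realMachine ls).argmax f).val
      = (List.finRange m).foldl (fun b k => if f k ≤ f b then b else k) 0 := by
    unfold argmax
    rw [val_foldlM]
    congr 1
    funext b k
    simp [val_bind, val_pure, realMachine]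
  rw [hf]
  exact (h _ _).2 k (List.mem_finRange k)

theorem argmax_ops [NeZero m] (f : Fin m → ℝ) : ((realMachine ls).argmax f).ops = m := by
  unfold argmax
  rw [ops_foldlM (c := 1) fun b i => rfl]
  simp

/-- The data that the preparation computes. -/
noncomputable def setupData (C : Tensor m n ℝ) (p : Vecs m n ℝ) (ε : ℝ) : Setup m n ℝ :=
  ⟨C, gammaOf m n ε, ‖C‖, perturbed C p ε, fun i => C i / gammaOf m n ε, 3 * ε / 8⟩

theorem setup_val (C : Tensor m n ℝ) (p : Vecs m n ℝ) (ε : ℝ) :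
    ((realMachine ls).setup C p ε).val = setupData C p ε := by
  unfold setup
  simp only [val_bind, val_pure, val_tabulate, supNorm_val]
  simp only [realMachine, setupData, gammaOf, Nat.cast_ofNat, Nat.cast_one]
  rfl

theorem setup_ops_le (C : Tensor m n ℝ) (p : Vecs m n ℝ) (ε : ℝ) :
    ((realMachine ls).setup C p ε).ops ≤ 25 + 3 * n ^ m + 2 * (m * n) := by
  unfold setup
  apply le_trans
  · repeat' with_reducible first
        | intro _
        | apply ops_bind_le
        | apply ops_tabulate_le
        | exact Nat.le_of_eq (const_ops ls _)
        | exact Nat.le_of_eq (supNorm_ops ls _)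
        | exact Nat.le_of_eq (log_ops ls _)
        | exact Nat.le_of_eq (add_ops ls _ _)
        | exact Nat.le_of_eq (sub_ops ls _ _)
        | exact Nat.le_of_eq (mul_ops ls _ _)
        | exact Nat.le_of_eq (div_ops ls _ _)
        | exact Nat.le_of_eq (ops_pure _)
  · simp only [Fintype.card_fin, Fintype.card_fun]
    linarith

variable (C : Tensor m n ℝ) (p : Vecs m n ℝ) (ε : ℝ)

theorem kernel_val (u : Vecs m n ℝ) :
    ((realMachine ls).kernel (setupData C p ε) u).val = kernelTensor C (gammaOf m n ε) u := by
  unfold kernel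
  rw [val_bind, val_tabulate, tensorSum_val]
  rfl

theorem kernel_ops (E : Setup m n ℝ) (u : Vecs m n ℝ) :
    ((realMachine ls).kernel E u).ops = n ^ m * (3 + m) := by
  unfold kernel
  rw [ops_bind, ops_tabulate, tensorSum_ops]
  simp [ops_bind, sub_ops, exp_ops]
  ring

theorem dualValue_val (u : Vecs m n ℝ) :
    ((realMachine ls).dualValue (setupData C p ε)
      (kernelSum C (gammaOf m n ε) u) u).val = dualObj C (gammaOf m n ε) (perturbed C p ε) u := by
  unfold dualValue
  simp only [val_bind, dot_val]
  rfl

theorem dualValue_ops_le (E : Setup m n ℝ) (σ : ℝ) (u : Vecs m n ℝ) :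
    ((realMachine ls).dualValue E σ u).ops ≤ 4 + m * (2 + 2 * n) := by
  unfold dualValue
  apply le_trans
  · repeat' with_reducible first
        | intro _
        | apply ops_bind_le
        | exact Nat.le_of_eq (log_ops ls _)
        | exact Nat.le_of_eq (sub_ops ls _ _)
        | exact Nat.le_of_eq (mul_ops ls _ _)
        | exact dot_ops_le ls _ _
  · linarith

theorem stopTest_val (X : Tensor m n ℝ) (v : ℝ) :
    ((realMachine ls).stopTest (setupData C p ε) X v).val = true ↔
      2 * ‖C‖ * (∑ k, ∑ j, |marginal X k j - perturbed C p ε k j|)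
        + primalObj C (gammaOf m n ε) X + v ≤ 3 * ε / 8 := by
  unfold stopTest
  simp only [val_bind, sum_val, marginals_val]
  simp [realMachine, setupData, primalObj, cost]

theorem stopTest_ops_le (E : Setup m n ℝ) (X : Tensor m n ℝ) (v : ℝ) :
    ((realMachine ls).stopTest E X v).ops ≤ 11 + m * (2 + 4 * n + n ^ m) + 5 * n ^ m := by
  unfold stopTest
  apply le_trans
  · repeat' with_reducible first
        | intro _
        | apply ops_bind_le
        | apply sum_ops_le
        | exact Nat.le_of_eq (const_ops ls _)
        | exact Nat.le_of_eq (marginals_ops ls _)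
        | exact Nat.le_of_eq (log_ops ls _)
        | exact Nat.le_of_eq (abs_ops ls _)
        | exact Nat.le_of_eq (add_ops ls _ _)
        | exact Nat.le_of_eq (sub_ops ls _ _)
        | exact Nat.le_of_eq (mul_ops ls _ _)
        | exact Nat.le_of_eq (le_ops ls _ _)
  · simp only [card_univ, Fintype.card_fin, Fintype.card_fun]
    linarith

theorem start_val : (realMachine ls).start.val = State.init m n := by
  simp [start, val_bind, val_pure, realMachine, State.init]

theorem start_ops : (realMachine ls).start.ops = 1 := rfl

theorem round_val [NeZero m] (V : Tensor m n ℝ) :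
    ((realMachine ls).round p V).val = rounding p V := by
  unfold round
  simp only [val_bind, val_foldlM, val_tabulate, marginalDir_val, marginals_val, sum_val, prod_val,
    val_pure]
  have hs : (fun (V : Tensor m n ℝ) (r : Fin m) => fun i : Fin m → Fin n =>
      ((realMachine ls).mul (V i) ((realMachine ls).min
        ((realMachine ls).div (p r (i r)) (marginal V r (i r))).val
        ((realMachine ls).const 1).val).val).val) = scaleDir p := by
    funext V r i
    simp [realMachine, scaleDir]
  rw [hs]
  funext i
  simp [realMachine, rounding, scaled]

theorem round_ops_le [NeZero m] (V : Tensor m n ℝ) :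
    ((realMachine ls).round p V).ops ≤ 4 + m * (6 * n + 3 * n ^ m + 1) + 2 * n + n ^ m * (m + 3) := by
  unfold round
  apply le_trans
  · repeat' with_reducible first
        | intro _
        | apply ops_bind_le
        | apply ops_tabulate_le
        | apply sum_ops_le
        | apply prod_ops_le
        | apply ops_foldlM_le
        | exact Nat.le_of_eq (const_ops ls _)
        | exact Nat.le_of_eq (marginals_ops ls _)
        | exact Nat.le_of_eq (marginalDir_ops ls _ _)
        | exact Nat.le_of_eq (abs_ops ls _)
        | exact Nat.le_of_eq (add_ops ls _ _)
        | exact Nat.le_of_eq (sub_ops ls _ _)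
        | exact Nat.le_of_eq (mul_ops ls _ _)
        | exact Nat.le_of_eq (div_ops ls _ _)
        | exact Nat.le_of_eq (min_ops ls _ _)
        | exact Nat.le_of_eq (ops_pure _)
  · simp only [card_univ, Fintype.card_fin, Fintype.card_fun, List.length_finRange]
    have : m - 1 ≤ m := Nat.sub_le _ _
    nlinarith

theorem iteration_ops_le [NeZero m] (hm : 1 ≤ m) (hn : 1 ≤ n) (E : Setup m n ℝ)
    (s : State m n ℝ) : ((realMachine ls).iteration E s).ops ≤ 200 * (m * n ^ m) := by
  have h1 : n ≤ n ^ m := Nat.le_self_pow (by omega) n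
  have h2 : m * n ≤ m * n ^ m := Nat.mul_le_mul_left m h1
  have h3 : n ^ m ≤ m * n ^ m := Nat.le_mul_of_pos_left _ hm
  have h4 : m ≤ m * n ^ m := Nat.le_mul_of_pos_right _ (by positivity)
  have h5 : 1 ≤ m * n ^ m := hm.trans h4
  unfold iteration
  dsimp only
  apply le_trans
  · repeat' with_reducible first
        | intro _
        | apply ops_bind_le
        | apply ops_tabulate_le
        | apply sum_ops_le
        | apply ops_ite_le
        | exact Nat.le_of_eq (const_ops ls _)
        | exact Nat.le_of_eq (sqrt_ops ls _)
        | exact Nat.le_of_eq (log_ops ls _)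
        | exact Nat.le_of_eq (add_ops ls _ _)
        | exact Nat.le_of_eq (sub_ops ls _ _)
        | exact Nat.le_of_eq (mul_ops ls _ _)
        | exact Nat.le_of_eq (div_ops ls _ _)
        | exact Nat.le_of_eq (le_ops ls _ _)
        | exact Nat.le_of_eq (ops_pure _)
        | exact Nat.le_of_eq (lineMin_ops ls _ _ _)
        | exact Nat.le_of_eq (tensorSum_ops ls _)
        | exact Nat.le_of_eq (marginals_ops ls _)
        | exact Nat.le_of_eq (total_ops ls _)
        | exact Nat.le_of_eq (argmax_ops ls _)
        | exact Nat.le_of_eq (kernel_ops ls _ _)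
        | exact dot_ops_le ls _ _
        | exact dualValue_ops_le ls _ _ _
        | exact stopTest_ops_le ls _ _ _
  · simp only [card_univ, Fintype.card_fin, Fintype.card_fun]
    linarith

end Machine

/-! ### An iteration of the program realizes a step of the method -/

namespace Machine

open Counted

theorem val_bind_of {α β : Type} {x : Counted α} {v : α} (h : x.val = v) (f : α → Counted β) :
    (x >>= f).val = (f v).val := by
  rw [val_bind, h]

/-- The outcome of an iteration when the gradient vanishes. -/
noncomputable def flatState (C : Tensor m n ℝ) (γ : ℝ) (q : Vecs m n ℝ) (s : State m n ℝ)
    (θ : Vecs m n ℝ) (I : Fin m) : State m n ℝ :=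
  ⟨blockMin C γ q θ I, s.ζ, s.A, primalOf C γ θ⟩

/-- The weight of an accelerated step. -/
noncomputable def stepWeight (A G v v' : ℝ) : ℝ :=
  (v - v' + √((v - v') * (v - v') + ((v - v') * A * G + (v - v') * A * G))) / G

/-- The outcome of an iteration with weight `w`. -/
noncomputable def acceleratedState (C : Tensor m n ℝ) (γ : ℝ) (q : Vecs m n ℝ) (s : State m n ℝ)
    (θ : Vecs m n ℝ) (I : Fin m) (w : ℝ) : State m n ℝ :=
  ⟨blockMin C γ q θ I, s.ζ - w • dualGrad C γ q θ, s.A + w,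
    fun i => (w * primalOf C γ θ i + s.A * s.X i) / (s.A + w)⟩

variable (ls : Tensor m n ℝ → Tensor m n ℝ → ℝ → ℝ)

theorem blockSq_eq_sum_mul (g : Vecs m n ℝ) :
    (tabulate fun k => (realMachine ls).sum univ fun j => (realMachine ls).mul (g k j) (g k j)).val
      = blockSq g := by
  funext k
  refine (sum_val ls _ _).trans ?_
  exact sum_congr rfl fun j _ => (sq _).symm

/-- The program is evaluated one bind at a time, each intermediate value being replaced by its
mathematical name before it is substituted further. Naming `β`, `θ` and `I` by existential variables
keeps the terms small. -/
theorem iteration_val [NeZero m] (C : Tensor m n ℝ) (p : Vecs m n ℝ) (ε : ℝ) {γ : ℝ}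
    (hγ : γ = gammaOf m n ε) {q : Vecs m n ℝ} (hq : q = perturbed C p ε) (s : State m n ℝ) :
    ∃ (β : ℝ) (θ : Vecs m n ℝ) (I : Fin m) (s' : State m n ℝ),
      β = ls (fun i => ∑ k, s.η k (i k) - C i / γ) (fun i => ∑ k, (s.ζ - s.η) k (i k))
        (pairing (s.ζ - s.η) q) ∧
      θ = s.η + β • (s.ζ - s.η) ∧
      (∀ k, blockSq (dualGrad C γ q θ) k ≤ blockSq (dualGrad C γ q θ) I) ∧
      s' = (if ∑ k, blockSq (dualGrad C γ q θ) k ≤ 0 then flatState C γ q s θ I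
        else acceleratedState C γ q s θ I (stepWeight s.A
          (∑ k, blockSq (dualGrad C γ q θ) k) (dualObj C γ q θ)
          (dualObj C γ q (blockMin C γ q θ I)))) ∧
      ((realMachine ls).iteration (setupData C p ε) s).val =
        (s', ((realMachine ls).stopTest (setupData C p ε) s'.X (dualObj C γ q s'.η)).val) := by
  subst hγ hq
  set γ := gammaOf m n ε with hγ
  set q := perturbed C p ε with hq
  obtain ⟨β, hβ⟩ : ∃ β, β = ls (fun i => ∑ k, s.η k (i k) - C i / γ)
    (fun i => ∑ k, (s.ζ - s.η) k (i k)) (pairing (s.ζ - s.η) q) := ⟨_, rfl⟩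
  obtain ⟨θ, hθ⟩ : ∃ θ, θ = s.η + β • (s.ζ - s.η) := ⟨_, rfl⟩
  obtain ⟨I, hI⟩ : ∃ I, I = ((realMachine ls).argmax (blockSq (dualGrad C γ q θ))).val := ⟨_, rfl⟩
  refine ⟨β, θ, I, _, hβ, hθ, fun k => by rw [hI]; exact argmax_spec ls _ k, rfl, ?_⟩
  unfold iteration
  dsimp only
  refine (val_bind_of (v := s.ζ - s.η) rfl _).trans ?_
  refine (val_bind_of (tensorSum_val ls _) _).trans ?_
  refine (val_bind_of (v := fun i => ∑ k, s.η k (i k) - C i / γ) rfl _).trans ?_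
  refine (val_bind_of (tensorSum_val ls _) _).trans ?_
  refine (val_bind_of (dot_val ls _ _) _).trans ?_
  refine (val_bind_of (v := β) hβ.symm _).trans ?_
  refine (val_bind_of (v := θ) hθ.symm _).trans ?_
  refine (val_bind_of (kernel_val ls C p ε θ) _).trans ?_
  refine (val_bind_of (v := kernelSum C γ θ) (total_val ls _) _).trans ?_
  refine (val_bind_of (marginals_val ls _) _).trans ?_
  refine (val_bind_of (v := dualGrad C γ q θ) rfl _).trans ?_
  refine (val_bind_of (blockSq_eq_sum_mul ls _) _).trans ?_
  refine (val_bind_of (v := ∑ k, blockSq (dualGrad C γ q θ) k) (sum_val ls _ _) _).trans ?_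
  refine (val_bind_of hI.symm _).trans ?_
  refine (val_bind_of (v := fun j => θ I j + Real.log (q I j)
    - Real.log (marginal (kernelTensor C γ θ) I j)) rfl _).trans ?_
  beta_reduce
  have hη : (fun k j => if k = I then θ I j + Real.log (q I j)
      - Real.log (marginal (kernelTensor C γ θ) I j) else θ k j) = blockMin C γ q θ I := by
    funext k j
    by_cases hk : k = I
    · subst hk; simp [blockMin]
    · simp [blockMin, hk]
  rw [hη]
  set η' := blockMin C γ q θ I with hη'
  refine (val_bind_of (kernel_val ls C p ε η') _).trans ?_
  refine (val_bind_of (v := kernelSum C γ η') (total_val ls _) _).trans ?_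
  refine (val_bind_of (dualValue_val ls C p ε θ) _).trans ?_
  refine (val_bind_of (dualValue_val ls C p ε η') _).trans ?_
  refine (val_bind_of (v := primalOf C γ θ) rfl _).trans ?_
  refine (val_bind_of (v := 0) (by simp [realMachine]) _).trans ?_
  refine (val_bind_of rfl _).trans ?_
  have hle : ((realMachine ls).le (∑ k, blockSq (dualGrad C γ q θ) k) 0).val
      = decide (∑ k, blockSq (dualGrad C γ q θ) k ≤ 0) := rfl
  rw [hle, val_ite]
  simp only [decide_eq_true_eq]
  split_ifs
  · rfl
  · rfl

/-- An iteration of the program is a step of the method, with its stopping test. -/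
theorem iteration_spec [NeZero m] {ls : Tensor m n ℝ → Tensor m n ℝ → ℝ → ℝ}
    (hls : IsExactLineSearch ls) (hn : 2 ≤ n) {C : Tensor m n ℝ} {p : Vecs m n ℝ}
    (hp : ∀ k, p k ∈ stdSimplex ℝ (Fin n)) {ε : ℝ} (hε : 0 < ε) (hε' : ε ≤ 32 * m * ‖C‖)
    {s : State m n ℝ} (hA : 0 ≤ s.A) :
    Step C (gammaOf m n ε) (perturbed C p ε) s
        ((realMachine ls).iteration (setupData C p ε) s).val.1 ∧
      (((realMachine ls).iteration (setupData C p ε) s).val.2 = true ↔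
        Stop C p ε ((realMachine ls).iteration (setupData C p ε) s).val.1) := by
  have : NeZero n := ⟨by omega⟩
  obtain ⟨β, θ, I, s', hβ, hθ, hI, hs', hval⟩ := iteration_val ls C p ε rfl rfl s
  have hγ := gammaOf_pos (m := m) hn hε
  have hq := perturbed_pos (C := C) hp hε hε'
  have hq1 := sum_perturbed (C := C) (ε := ε) hp
  rw [hval]
  refine ⟨?_, stopTest_val ls C p ε _ _⟩
  clear hval
  set γ := gammaOf m n ε
  set q := perturbed C p ε
  have hβ1 := (hls (fun i => ∑ k, s.η k (i k) - C i / γ) (fun i => ∑ k, (s.ζ - s.η) k (i k))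
    (pairing (s.ζ - s.η) q))
  rw [← hβ] at hβ1
  have hmin : IsMinOn (fun b : ℝ => dualObj C γ q (s.η + b • (s.ζ - s.η))) (Set.Icc 0 1) β := by
    -- On the segment, `φ` is `γ > 0` times the function handed to the line search, up to an
    -- additive constant, so the minimizers agree.
    have hf : ∀ b : ℝ, dualObj C γ q (s.η + b • (s.ζ - s.η))
        = γ * ((Real.log (∑ i, Real.exp ((∑ k, s.η k (i k) - C i / γ)
          + b * ∑ k, (s.ζ - s.η) k (i k))) - b * pairing (s.ζ - s.η) q) - pairing s.η q) := by
      intro b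
      rw [dualObj_eq, pairing_add_left, pairing_smul_left, kernelSum]
      have : ∀ i, kernelTensor C γ (s.η + b • (s.ζ - s.η)) i
          = Real.exp ((∑ k, s.η k (i k) - C i / γ) + b * ∑ k, (s.ζ - s.η) k (i k)) := by
        intro i
        rw [kernelTensor]
        simp only [Pi.add_apply, Pi.smul_apply, smul_eq_mul, sum_add_distrib, mul_sum]
        congr 1
        ring
      simp only [this]
      ring
    intro b hb
    have h := hβ1.2 hb
    change dualObj C γ q (s.η + β • (s.ζ - s.η)) ≤ dualObj C γ q (s.η + b • (s.ζ - s.η))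
    change _ - β * _ ≤ _ - b * _ at h
    rw [hf, hf]
    exact mul_le_mul_of_nonneg_left (by linarith) hγ.le
  split_ifs at hs' with hG
  · subst hs'
    have hg : dualGrad C γ q θ = 0 :=
      sum_blockSq_eq_zero.1 (le_antisymm hG (sum_blockSq_nonneg _))
    exact ⟨β, θ, I, hmin, hβ1.1, hθ, hI, rfl, fun h => absurd hg h, fun _ => ⟨rfl, rfl, rfl⟩⟩
  · subst hs'
    have hG0 := not_le.1 hG
    -- A nonzero gradient makes its largest block nonzero, so minimization over that block strictly
    -- decreases `φ`; this makes the computed root the greatest solution.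
    have hv : dualObj C γ q (blockMin C γ q θ I) < dualObj C γ q θ := by
      have h1 := blockSq_le_dualObj_sub (C := C) (γ := γ) hq hq1 θ I
      have h2 : 0 < blockSq (dualGrad C γ q θ) I := by
        by_contra hcon
        exact hG (sum_nonpos fun k _ => (hI k).trans (not_lt.1 hcon))
      by_contra hcon
      have : 2 * γ * (dualObj C γ q θ - dualObj C γ q (blockMin C γ q θ I)) ≤ 0 :=
        mul_nonpos_of_nonneg_of_nonpos (by positivity) (by linarith)
      linarith
    refine ⟨β, θ, I, hmin, hβ1.1, hθ, hI, rfl, fun _ => ?_, fun h => ?_⟩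
    · exact ⟨_, (isGreatest_weight hA hG0 hv).2, rfl, rfl, rfl⟩
    · rw [sum_blockSq_eq_zero.2 h] at hG0
      exact absurd hG0 (lt_irrefl _)

end Machine

/-- The test evaluated in iteration `t` concerns the state `s (t + 1)`; a first success at index `T`
therefore means `T + 1` executions of the body. -/
theorem repeatUntil_iterate {σ : Type} (body : σ → Counted (σ × Bool)) {B : ℕ}
    (hB : ∀ s, (body s).ops ≤ B) (s : ℕ → σ) (hs : ∀ t, s (t + 1) = (body (s t)).val.1) (T : ℕ)
    (hT : (body (s T)).val.2 = true) (hlt : ∀ t < T, (body (s t)).val.2 = false) :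
    ∃ N ≤ (T + 1) * B, RepeatUntil body (s 0) (s (T + 1)) (T + 1) N := by
  induction T generalizing s with
  | zero =>
    refine ⟨(body (s 0)).ops, ?_, ?_⟩
    · simpa using hB (s 0)
    · rw [hs 0]
      exact RepeatUntil.last _ hT
  | succ T ih =>
    obtain ⟨N, hN, hr⟩ := ih (fun t => s (t + 1)) (fun t => hs (t + 1)) hT
      fun t ht => hlt (t + 1) (by omega)
    refine ⟨(body (s 0)).ops + N, ?_, ?_⟩
    · have := hB (s 0)
      linarith
    · refine RepeatUntil.next _ _ _ _ (hlt 0 (by omega)) ?_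
      rw [← hs 0]
      exact hr

/-! ### The iteration bound, the execution of the program and the total cost -/

section Bounds

variable {C : Tensor m n ℝ} {p : Vecs m n ℝ} {ε : ℝ}

/-- Absorbs the `log n` coming from `γ` into `ℓ = log (2 + x)`: since `n ≤ 32 (2 + x)`, `log n ≤ 5
log 2 + ℓ ≤ 6ℓ`, and `ℓ ≥ 2/3` gives `6ℓ ≤ 9ℓ²`. The square is convenient because the iteration
bound takes a root. -/
theorem log_le_nine_mul_sq {x : ℝ} (hx : (n : ℝ) / 32 ≤ x) (hn : 1 ≤ n) :
    2 / 3 ≤ Real.log (2 + x) ∧ Real.log n ≤ 9 * Real.log (2 + x) ^ 2 := by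
  have hn' : (1 : ℝ) ≤ n := by exact_mod_cast hn
  have h2 : Real.log 2 ≤ Real.log (2 + x) := Real.log_le_log two_pos (by linarith)
  have h1 : 2 / 3 ≤ Real.log (2 + x) := by linarith [Real.log_two_gt_d9]
  have h3 : Real.log n ≤ Real.log (2 ^ 5 * (2 + x)) :=
    Real.log_le_log (by linarith) (by linarith)
  rw [Real.log_mul (by norm_num) (by linarith), Real.log_pow] at h3
  push_cast at h3
  exact ⟨h1, by nlinarith⟩

/-- The number of iterations after which the stopping test has succeeded. -/
theorem exists_stopsAt_le [NeZero m] (hm : 2 ≤ m) (hn : 2 ≤ n)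
    (hp : ∀ k, p k ∈ stdSimplex ℝ (Fin n)) (hε : 0 < ε) (hε' : ε ≤ 32 * m * ‖C‖)
    {s : ℕ → State m n ℝ} (hs : IsRun C p ε s) :
    ∃ T : ℕ, StopsAt C p ε s T ∧
      (T : ℝ) ≤ 45 * ((m : ℝ) ^ 2 * (n : ℝ) ^ (1 / 2 : ℝ) * ‖C‖ / ε)
        * Real.log (2 + m * n * ‖C‖ / ε) ^ 1 := by
  have : NeZero n := ⟨by omega⟩
  have hC := norm_pos_of_le hε hε'
  have hγ := gammaOf_pos (m := m) hn hε
  have hmR : (2 : ℝ) ≤ m := by exact_mod_cast hm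
  have hnR : (2 : ℝ) ≤ n := by exact_mod_cast hn
  have hl : 0 < Real.log n := Real.log_pos (by linarith)
  obtain ⟨hℓ, hlog⟩ := log_le_nine_mul_sq (n := n) (x := m * n * ‖C‖ / ε) (by
    rw [div_le_div_iff₀ (by norm_num) hε]
    nlinarith) (by omega)
  set ℓ := Real.log (2 + m * n * ‖C‖ / ε) with hℓdef
  rw [← Real.sqrt_eq_rpow, pow_one]
  set r := √(n : ℝ) with hr
  have hr2 : r ^ 2 = n := Real.sq_sqrt (by linarith)
  have hr1 : 1 ≤ r := by
    rw [hr, Real.one_le_sqrt]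
    linarith
  set Q := (m : ℝ) ^ 2 * r * ‖C‖ / ε with hQ
  have hQ1 : 1 / 16 ≤ Q := by
    rw [hQ, div_le_div_iff₀ (by norm_num) hε]
    have h1 : (m : ℝ) * ‖C‖ * 2 ≤ m * ‖C‖ * (m * r) :=
      mul_le_mul_of_nonneg_left (by nlinarith) (by positivity)
    nlinarith
  -- The gap after `N` steps is at most `16 m³ n ‖C‖² log n / (ε N²)`, so `N² ≥ (128/3) m³ n ‖C‖²
  -- log n / ε²` suffices. The constant is rounded up to 49, and `49 · 9 = 21²`.
  set N := ⌈21 * Q * ℓ⌉₊ with hN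
  have hN1 : 21 * Q * ℓ ≤ N := Nat.le_ceil _
  have hN2 : (N : ℝ) < 21 * Q * ℓ + 1 := Nat.ceil_lt_add_one (by positivity)
  have hQℓ : 1 / 24 ≤ Q * ℓ := by nlinarith
  have hNpos : 1 ≤ N := by
    rw [hN, Nat.one_le_ceil_iff]
    linarith
  obtain ⟨t, ht1, htN, hgap⟩ := exists_gap_le hγ (perturbed_pos hp hε hε') (sum_perturbed hp)
    hs.1 hs.2 (2 * ‖C‖) hNpos
  have hNR : (0 : ℝ) < N := by exact_mod_cast hNpos
  have hbound : 2 * (2 * ‖C‖) ^ 2 * m ^ 2 * n / (gammaOf m n ε * N ^ 2) ≤ 3 * ε / 8 := by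
    have h1 : (21 * Q * ℓ) ^ 2 ≤ (N : ℝ) ^ 2 := pow_le_pow_left₀ (by positivity) hN1 2
    have h2 : (21 * Q * ℓ) ^ 2 = 441 * (m ^ 4 * n * ‖C‖ ^ 2 / ε ^ 2) * ℓ ^ 2 := by
      rw [hQ, ← hr2]
      field_simp
      norm_num
    have h3 : 49 * (m ^ 3 * n * ‖C‖ ^ 2 / ε ^ 2) * Real.log n ≤ (N : ℝ) ^ 2 := by
      calc 49 * (m ^ 3 * n * ‖C‖ ^ 2 / ε ^ 2) * Real.log n
          ≤ 49 * (m ^ 4 * n * ‖C‖ ^ 2 / ε ^ 2) * (9 * ℓ ^ 2) := by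
            gcongr
            · linarith
            · norm_num
        _ = (21 * Q * ℓ) ^ 2 := by rw [h2]; ring
        _ ≤ _ := h1
    rw [div_le_iff₀ (by positivity)]
    calc 2 * (2 * ‖C‖) ^ 2 * m ^ 2 * n ≤ 147 / 16 * (‖C‖ ^ 2 * m ^ 2 * n) := by
          have : 0 ≤ ‖C‖ ^ 2 * m ^ 2 * n := by positivity
          nlinarith
      _ = 3 * ε / 8 * (gammaOf m n ε * (49 * (m ^ 3 * n * ‖C‖ ^ 2 / ε ^ 2) * Real.log n)) := by
          unfold gammaOf
          field_simp
          norm_num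
      _ ≤ _ := by gcongr
  have htest : Stop C p ε (s t) := hgap.trans hbound
  classical
  have hex : ∃ t, 1 ≤ t ∧ Stop C p ε (s t) := ⟨t, ht1, htest⟩
  refine ⟨Nat.find hex, ⟨Nat.find_spec hex, fun t' ht' => Nat.find_min' hex ht'⟩, ?_⟩
  have h1 : (Nat.find hex : ℝ) ≤ N := by
    exact_mod_cast (Nat.find_min' hex ⟨ht1, htest⟩).trans htN
  -- The rounding up costs `1 ≤ 24 Q ℓ`, whence `21 + 24 = 45`.
  linarith

theorem StopsAt.isApproxSolution [NeZero m] (hm : 2 ≤ m) (hn : 2 ≤ n) (hC : ∀ i, 0 ≤ C i)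
    (hp : ∀ k, p k ∈ stdSimplex ℝ (Fin n)) (hε : 0 < ε) (hε' : ε ≤ 32 * m * ‖C‖)
    {s : ℕ → State m n ℝ} (hs : IsRun C p ε s) {T : ℕ} (hT : StopsAt C p ε s T) :
    IsApproxSolution C p ε (rounding p (s T).X) := by
  have : NeZero n := ⟨by omega⟩
  have hγ := gammaOf_pos (m := m) hn hε
  have hq := perturbed_pos (C := C) hp hε hε'
  have hq1 := sum_perturbed (C := C) (ε := ε) hp
  obtain ⟨h1, h2⟩ := hT.1
  obtain ⟨t, rfl⟩ : ∃ t, T = t + 1 := ⟨T - 1, by omega⟩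
  obtain ⟨h3, h4⟩ := (hs.2 t).normalized hγ hq hq1 (normalized_of_steps hγ hq hq1 hs.1 hs.2 t)
  exact h2.isApproxSolution hm hn hC hp hε hε' h3.X_nonneg h4

/-- The program follows a run of the method. -/
theorem exists_run_executes [NeZero m] (hm : 2 ≤ m) (hn : 2 ≤ n)
    (hp : ∀ k, p k ∈ stdSimplex ℝ (Fin n)) (hε : 0 < ε) (hε' : ε ≤ 32 * m * ‖C‖)
    {ls : Tensor m n ℝ → Tensor m n ℝ → ℝ → ℝ} (hls : IsExactLineSearch ls) :
    ∃ (s : ℕ → State m n ℝ) (T N : ℕ), IsRun C p ε s ∧ StopsAt C p ε s T ∧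
      Executes (realMachine ls) C p ε (rounding p (s T).X) T N ∧
      N ≤ 300 * (m * n ^ m) * T ∧
      (T : ℝ) ≤ 45 * ((m : ℝ) ^ 2 * (n : ℝ) ^ (1 / 2 : ℝ) * ‖C‖ / ε)
        * Real.log (2 + m * n * ‖C‖ / ε) ^ 1 := by
  have : NeZero n := ⟨by omega⟩
  have hγ := gammaOf_pos (m := m) hn hε
  have hq := perturbed_pos (C := C) hp hε hε'
  have hq1 := sum_perturbed (C := C) (ε := ε) hp
  set body := (realMachine ls).iteration (Machine.setupData C p ε) with hbody
  -- The body is iterated forever, ignoring its test, to obtain an infinite run; the execution of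
  -- the program is the part of it up to the first success.
  obtain ⟨s, hs0, hs⟩ : ∃ s : ℕ → State m n ℝ,
      s 0 = State.init m n ∧ ∀ t, s (t + 1) = (body (s t)).val.1 :=
    ⟨fun t => (fun st => (body st).val.1)^[t] (State.init m n), rfl,
      fun t => Function.iterate_succ_apply' _ _ _⟩
  have hnorm : ∀ t, Normalized (s t) := by
    intro t
    induction t with
    | zero => rw [hs0]; exact normalized_init
    | succ t ih =>
      rw [hs]
      exact ((Machine.iteration_spec hls hn hp hε hε' ih.A_nonneg).1.normalized hγ hq hq1 ih).1
  have hspec : ∀ t, Step C (gammaOf m n ε) (perturbed C p ε) (s t) (s (t + 1)) ∧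
      ((body (s t)).val.2 = true ↔ Stop C p ε (s (t + 1))) := fun t => by
    rw [hs]
    exact Machine.iteration_spec hls hn hp hε hε' (hnorm t).A_nonneg
  have hrun : IsRun C p ε s := ⟨hs0, fun t => (hspec t).1⟩
  obtain ⟨T, hT, hTle⟩ := exists_stopsAt_le hm hn hp hε hε' hrun
  obtain ⟨T', rfl⟩ : ∃ t, T = t + 1 := ⟨T - 1, by have := hT.1.1; omega⟩
  obtain ⟨k, hk, hrep⟩ := repeatUntil_iterate body
    (Machine.iteration_ops_le ls (by omega) (by omega) _) s hs T'
    ((hspec T').2.2 hT.1.2) (fun t ht => by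
      rw [Bool.eq_false_iff]
      intro hcon
      have := hT.2 ⟨Nat.le_add_left 1 t, (hspec t).2.1 hcon⟩
      omega)
  refine ⟨s, T' + 1, ((realMachine ls).setup C p ε).ops + (realMachine ls).start.ops + k
    + ((realMachine ls).round p (s (T' + 1)).X).ops, hrun, hT,
    ⟨s (T' + 1), k, ?_, (Machine.round_val ls p _).symm, rfl⟩, ?_, hTle⟩
  · rw [Machine.setup_val, Machine.start_val, ← hs0]
    exact hrep
  -- The iterations cost at most `200 m nᵐ` each; preparation, start and rounding together fit into
  -- the remaining `100 m nᵐ`, because at least one iteration takes place.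
  · have h1 : n ≤ n ^ m := Nat.le_self_pow (by omega) n
    have h2 : m * n ≤ m * n ^ m := Nat.mul_le_mul_left m h1
    have h3 : n ^ m ≤ m * n ^ m := Nat.le_mul_of_pos_left _ (by omega)
    have h4 : m ≤ m * n ^ m := Nat.le_mul_of_pos_right _ (by positivity)
    have h5 := Machine.setup_ops_le ls C p ε
    have h6 := Machine.round_ops_le ls p (s (T' + 1)).X
    have h7 := Machine.start_ops ls
    have h8 : m * n ^ m ≤ m * n ^ m * (T' + 1) := Nat.le_mul_of_pos_right _ (by omega)
    have h9 : m * (6 * n + 3 * n ^ m + 1) + n ^ m * (m + 3)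
        = 6 * (m * n) + 4 * (m * n ^ m) + m + 3 * n ^ m := by ring
    have h10 : (T' + 1) * (200 * (m * n ^ m)) = 200 * (m * n ^ m * (T' + 1)) := by ring
    have h11 : 300 * (m * n ^ m) * (T' + 1) = 300 * (m * n ^ m * (T' + 1)) := by ring
    rw [h10] at hk
    rw [h11]
    generalize m * n ^ m * (T' + 1) = b at *
    generalize m * n ^ m = a at *
    generalize ((realMachine ls).setup C p ε).ops = x at *
    generalize ((realMachine ls).round p (s (T' + 1)).X).ops = y at *
    omega

theorem total_cost_le [NeZero m] [NeZero n] {N T : ℕ} {ℓ : ℝ} (hN : N ≤ 300 * (m * n ^ m) * T)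
    (hT : (T : ℝ) ≤ 45 * ((m : ℝ) ^ 2 * (n : ℝ) ^ (1 / 2 : ℝ) * ‖C‖ / ε) * ℓ) :
    (N : ℝ) ≤ 13500 * ((m : ℝ) ^ 3 * (n : ℝ) ^ ((m : ℝ) + 1 / 2) * ‖C‖ / ε) * ℓ := by
  have hn : (0 : ℝ) < n := by exact_mod_cast NeZero.pos n
  have h1 : (N : ℝ) ≤ 300 * (m * (n : ℝ) ^ m) * T := by exact_mod_cast hN
  refine h1.trans ((mul_le_mul_of_nonneg_left hT (by positivity)).trans_eq ?_)
  rw [Real.rpow_add hn, Real.rpow_natCast]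
  ring

end Bounds

end MOT

theorem theorem3 :
    ∃ (K : ℝ) (d : ℕ), ∀ (m n : ℕ) [NeZero m] (_ : 2 ≤ m) (_ : 2 ≤ n)
      (C : MOT.Tensor m n ℝ) (_ : ∀ i, 0 ≤ C i)
      (p : MOT.Vecs m n ℝ) (_ : ∀ k, p k ∈ stdSimplex ℝ (Fin n))
      (ε : ℝ) (_ : 0 < ε) (_ : ε ≤ 32 * m * ‖C‖),
      -- every run stops, within the claimed number of iterations, at an `ε`-solution
      (∀ s : ℕ → MOT.State m n ℝ, MOT.IsRun C p ε s →
        ∃ T : ℕ, MOT.StopsAt C p ε s T ∧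
          (T : ℝ) ≤ K * ((m : ℝ) ^ 2 * (n : ℝ) ^ (1 / 2 : ℝ) * ‖C‖ / ε)
            * Real.log (2 + m * n * ‖C‖ / ε) ^ d ∧
          MOT.IsApproxSolution C p ε (MOT.rounding p (s T).X)) ∧
      -- the program carries out a run, with the claimed cost per iteration and in total
      (∀ ls : MOT.Tensor m n ℝ → MOT.Tensor m n ℝ → ℝ → ℝ, MOT.IsExactLineSearch ls →
        (∀ (E : MOT.Machine.Setup m n ℝ) (s : MOT.State m n ℝ),
          (((MOT.realMachine ls).iteration E s).ops : ℝ) ≤ K * (m * (n : ℝ) ^ m)) ∧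
        ∃ (s : ℕ → MOT.State m n ℝ) (T N : ℕ), MOT.IsRun C p ε s ∧ MOT.StopsAt C p ε s T ∧
          MOT.Executes (MOT.realMachine ls) C p ε (MOT.rounding p (s T).X) T N ∧
          (N : ℝ) ≤ K * ((m : ℝ) ^ 3 * (n : ℝ) ^ ((m : ℝ) + 1 / 2) * ‖C‖ / ε)
            * Real.log (2 + m * n * ‖C‖ / ε) ^ d) := by
  -- The product of 300 operations per `m nᵐ` and iteration with the factor 45 in the number of
  -- iterations; it dominates the other constants, and one logarithm suffices.
  refine ⟨13500, 1, ?_⟩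
  intro m n _ hm hn C hC p hp ε hε hε'
  have : NeZero n := ⟨by omega⟩
  have hx : 0 ≤ (m : ℝ) * n * ‖C‖ / ε := by positivity
  have hℓ : 0 ≤ Real.log (2 + m * n * ‖C‖ / ε) ^ 1 :=
    pow_nonneg (Real.log_nonneg (by linarith)) _
  refine ⟨fun s hs => ?_, fun ls hls => ⟨fun E s => ?_, ?_⟩⟩
  · obtain ⟨T, hT, hTle⟩ := MOT.exists_stopsAt_le hm hn hp hε hε' hs
    refine ⟨T, hT, hTle.trans ?_, hT.isApproxSolution hm hn hC hp hε hε' hs⟩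
    refine mul_le_mul_of_nonneg_right (mul_le_mul_of_nonneg_right (by norm_num) ?_) hℓ
    positivity
  · have h : (((MOT.realMachine ls).iteration E s).ops : ℝ) ≤ 200 * (m * (n : ℝ) ^ m) := by
      exact_mod_cast MOT.Machine.iteration_ops_le ls (by omega) (by omega) E s
    have h0 : (0 : ℝ) ≤ m * (n : ℝ) ^ m := by positivity
    linarith
  · obtain ⟨s, T, N, hrun, hT, hex, hN, hTle⟩ := MOT.exists_run_executes hm hn hp hε hε' hls
    exact ⟨s, T, N, hrun, hT, hex, MOT.total_cost_le hN hTle⟩
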